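/- **Conventions.** A *set system* on $U=\{0,\dots,n-1\}$ is a family $\mathcal I\subseteq 2^U$; it is *downward-closed* if $S\subseteq T\in\mathcal I$ implies $S\in\mathcal I$. Its *polytope* $\mathcal P_{\mathcal I}\subseteq[0,1]^n$ is the convex hull of the indicator vectors of the (inclusion-wise) maximal sets of $\mathcal I$. A function $f:2^U\to\mathbb R$ is *monotone* if $f(S)\le f(T)$ whenever $S\subseteq T$, and *submodular* if $f(S\cup T)+f(S\cap T)\le f(S)+f(T)$ for all $S,T$. A distribution $\mathcal D$ on $2^U$ has *marginals* $\mathbf x$ if $\Pr_{S\sim\mathcal D}[i\in S]=x_i$ for all $i$, and satisfies *Weak Negative Regression* (WNR) if for every $i\in U$ with $0<\Pr_{S\sim\mathcal D}[i\in S]<1$ and every monotone $g:2^U\to\mathbb R$, $$\mathbb E_{S\sim\mathcal D}[g(S\setminus\{i\})\mid i\in S]\;\le\;\mathbb E_{S\sim\mathcal D}[g(S\setminus\{i\})\mid i\notin S].$$ *Algorithms* are randomised real-RAM programs: exact arithmetic and comparisons on real numbers (no rounding; the only built-in real constant is $1$), natural-number counters, lists, general loops, and tosses of coins of any computed bias,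 each operation and oracle query costing one step. Let $\mathcal C$ be a class of set systems. Each member $\mathcal I\subseteq 2^{\{0,\dots,n-1\}}$ is presented to algorithms by $n$, a finite sequence of $m\ge 0$ real numbers, and oracle access to a function assigning a real number to every list of natural numbers (for instance a membership oracle, or a constant). An algorithm is *efficient* on $\mathcal C$ if, for some polynomial $P$, on every member of $\mathcal C$ and for every outcome of its coin tosses it halts after at most $P(n+m)$ steps. * $\mathcal C$ has *solvable polytopes* if an efficient algorithm, given the presentation of any $\mathcal I\in\mathcal C$ and any $c\in\mathbb R^n$, always returns a maximiser of $x\mapsto\sum_i c_ix_i$ over $\mathcal P_{\mathcal I}$. * $\mathcal C$ *efficiently admits WNR distributions* if an efficient algorithm, given the presentation of any $\mathcal I\in\mathcal C$ and any $\mathbf x\in\mathcal P_{\mathcal I}$, returns a random set in $\mathcal I$ whose distribution is WNR with marginals $\mathbf x$. **Theorem (Submodular Maximization).** There is a function $\varepsilon:\mathbb N\to\mathbb R$ with $\varepsilon(n)\to0$ as $n\to\infty$ such that the following holds. Let $\mathcal C$ be a class of downward-closed set systems that has solvable polytopes and efficiently admits WNR distributions. Then there is an efficient algorithm which, given the presentation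 of any $\mathcal I\in\mathcal C$, $\mathcal I\subseteq2^{\{0,\dots,n-1\}}$, and value-oracle access to any monotone submodular function $f:2^{\{0,\dots,n-1\}}\to\mathbb R_{\ge0}$, always returns a set $T\in\mathcal I$, and $$\mathbb E[f(T)]\;\ge\;\Bigl(1-\frac1e-\varepsilon(n)\Bigr)\cdot\max_{S\in\mathcal I}f(S).$$ -/

import Mathlib

/-! ## Randomised real-RAM programs with a step count

A small first-order programming language over natural numbers, exact real numbers, pairs, tagged
unions and lists, with unit-cost operations, general (unbounded) loops, biased coins and oracle
queries.  There is no rounding operation on reals and the only real constants are those computable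
from `1`, so the language is the uniform, constant-free randomised real RAM up to polynomial
overhead. -/

namespace SubmodMax

/-- Data types of the language. -/
inductive Ty : Type
  | unit : Ty
  | nat : Ty
  | real : Ty
  | prod : Ty → Ty → Ty
  | sum : Ty → Ty → Ty
  | list : Ty → Ty

/-- The values of a data type. -/
@[reducible] def Ty.val : Ty → Type
  | .unit => Unit
  | .nat => ℕ
  | .real => ℝ
  | .prod a b => a.val × b.val
  | .sum a b => a.val ⊕ b.val
  | .list a => List a.val

/-- Truth values: `Sum.inl ()` is "yes", `Sum.inr ()` is "no". -/
abbrev Ty.bool : Ty := .sum .unit .unit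

/-- Deterministic primitive operations, each of which takes one step. -/
inductive Prim : Ty → Ty → Type
  | id {a : Ty} : Prim a a
  | unit {a : Ty} : Prim a .unit
  | fst {a b : Ty} : Prim (.prod a b) a
  | snd {a b : Ty} : Prim (.prod a b) b
  | inl {a b : Ty} : Prim a (.sum a b)
  | inr {a b : Ty} : Prim b (.sum a b)
  | nil {a b : Ty} : Prim a (.list b)
  | cons {a : Ty} : Prim (.prod a (.list a)) (.list a)
  | uncons {a : Ty} : Prim (.list a) (.sum .unit (.prod a (.list a)))
  | natZero {a : Ty} : Prim a .nat
  | natSucc : Prim .nat .nat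
  | natPred : Prim .nat (.sum .unit .nat)
  | natAdd : Prim (.prod .nat .nat) .nat
  | natLe : Prim (.prod .nat .nat) .bool
  | natCast : Prim .nat .real
  | realOne {a : Ty} : Prim a .real
  | realAdd : Prim (.prod .real .real) .real
  | realSub : Prim (.prod .real .real) .real
  | realMul : Prim (.prod .real .real) .real
  | realDiv : Prim (.prod .real .real) .real
  | realLe : Prim (.prod .real .real) .bool

/-- The function computed by a primitive operation (division by zero returns zero). -/
noncomputable def Prim.eval : {a b : Ty} → Prim a b → a.val → b.val
  | _, _, .id, x => x
  | _, _, .unit, _ => ()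
  | _, _, .fst, x => x.1
  | _, _, .snd, x => x.2
  | _, _, .inl, x => Sum.inl x
  | _, _, .inr, x => Sum.inr x
  | _, _, .nil, _ => []
  | _, _, .cons, x => x.1 :: x.2
  | _, _, .uncons, [] => Sum.inl ()
  | _, _, .uncons, y :: l => Sum.inr (y, l)
  | _, _, .natZero, _ => (0 : ℕ)
  | _, _, .natSucc, k => k + 1
  | _, _, .natPred, 0 => Sum.inl ()
  | _, _, .natPred, k + 1 => Sum.inr k
  | _, _, .natAdd, x => x.1 + x.2
  | _, _, .natLe, x => if x.1 ≤ x.2 then Sum.inl () else Sum.inr ()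
  | _, _, .natCast, k => (k : ℝ)
  | _, _, .realOne, _ => (1 : ℝ)
  | _, _, .realAdd, x => x.1 + x.2
  | _, _, .realSub, x => x.1 - x.2
  | _, _, .realMul, x => x.1 * x.2
  | _, _, .realDiv, x => x.1 / x.2
  | _, _, .realLe, x => if x.1 ≤ x.2 then Sum.inl () else Sum.inr ()

/-- Programs with input of type `a` and output of type `b`. -/
inductive Prog : Ty → Ty → Type
  /-- a primitive operation -/
  | prim {a b : Ty} : Prim a b → Prog a b
  /-- toss a coin whose bias is the given real number -/
  | flip : Prog .real .bool
  /-- query the oracle through which the set system is presented -/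
  | askSystem : Prog (.list .nat) .real
  /-- query the value oracle of the objective function -/
  | askValue : Prog (.list .nat) .real
  /-- run the first program, then the second one on its output -/
  | comp {a b c : Ty} : Prog a b → Prog b c → Prog a c
  /-- run both programs on the input and return the pair of outputs -/
  | pair {a b c : Ty} : Prog a b → Prog a c → Prog a (.prod b c)
  /-- branch on the tag of the first component -/
  | case {a b c d : Ty} : Prog (.prod a c) d → Prog (.prod b c) d → Prog (.prod (.sum a b) c) d
  /-- repeat the body on its own output as long as it returns `Sum.inl` -/
  | loop {a b : Ty} : Prog a (.sum a b) → Prog a b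

/-- The program contains no query to the value oracle of the objective function. -/
def Prog.NoValueQuery : {a b : Ty} → Prog a b → Prop
  | _, _, .prim _ => True
  | _, _, .flip => True
  | _, _, .askSystem => True
  | _, _, .askValue => False
  | _, _, .comp p q => p.NoValueQuery ∧ q.NoValueQuery
  | _, _, .pair p q => p.NoValueQuery ∧ q.NoValueQuery
  | _, _, .case p q => p.NoValueQuery ∧ q.NoValueQuery
  | _, _, .loop p => p.NoValueQuery

/-- A coin that shows `Sum.inl ()` with probability `p` (with `p` clamped to `[0, 1]`). -/
noncomputable def coin (p : ℝ) : PMF (Unit ⊕ Unit) :=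
  PMF.ofFintype
    (fun s => Sum.elim (fun _ => ENNReal.ofReal (max 0 (min 1 p)))
      (fun _ => ENNReal.ofReal (1 - max 0 (min 1 p))) s)
    (by
      have h0 : 0 ≤ max 0 (min 1 p) := le_max_left _ _
      have h1 : max 0 (min 1 p) ≤ 1 := max_le zero_le_one (min_le_left _ _)
      simp only [Fintype.sum_sum_type, Sum.elim_inl, Sum.elim_inr, Finset.univ_unique,
        Finset.sum_singleton]
      rw [← ENNReal.ofReal_add h0 (by linarith)]
      simp)

/-- Big-step semantics.  `Eval A V p x D` says: with oracles `A` (for the set system) and `V` (for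
the objective function), the program `p` started on input `x` halts on every outcome of its coin
tosses, and `D` is the joint distribution of its output and of its number of steps.  Distinct coin
tosses are independent. -/
inductive Eval (A V : List ℕ → ℝ) :
    {a b : Ty} → Prog a b → a.val → PMF (b.val × ℕ) → Prop
  | prim {a b : Ty} (o : Prim a b) (x : a.val) :
      Eval A V (.prim o) x (PMF.pure (o.eval x, 1))
  | flip (r : ℝ) :
      Eval A V .flip r ((coin r).map fun s => (s, 1))
  | askSystem (l : List ℕ) :
      Eval A V .askSystem l (PMF.pure (A l, 1))
  | askValue (l : List ℕ) :
      Eval A V .askValue l (PMF.pure (V l, 1))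
  | comp {a b c : Ty} (p : Prog a b) (q : Prog b c) (x : a.val)
      (D : PMF (b.val × ℕ)) (K : b.val → PMF (c.val × ℕ)) :
      Eval A V p x D →
      (∀ y ∈ D.support, Eval A V q y.1 (K y.1)) →
      Eval A V (.comp p q) x (D.bind fun y => (K y.1).map fun z => (z.1, y.2 + z.2 + 1))
  | pair {a b c : Ty} (p : Prog a b) (q : Prog a c) (x : a.val)
      (D : PMF (b.val × ℕ)) (E : PMF (c.val × ℕ)) :
      Eval A V p x D →
      Eval A V q x E →
      Eval A V (.pair p q) x (D.bind fun y => E.map fun z => ((y.1, z.1), y.2 + z.2 + 1))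
  | caseInl {a b c d : Ty} (p : Prog (.prod a c) d) (q : Prog (.prod b c) d)
      (u : a.val) (w : c.val) (D : PMF (d.val × ℕ)) :
      Eval A V p (u, w) D →
      Eval A V (.case p q) (Sum.inl u, w) (D.map fun z => (z.1, z.2 + 1))
  | caseInr {a b c d : Ty} (p : Prog (.prod a c) d) (q : Prog (.prod b c) d)
      (u : b.val) (w : c.val) (D : PMF (d.val × ℕ)) :
      Eval A V q (u, w) D →
      Eval A V (.case p q) (Sum.inr u, w) (D.map fun z => (z.1, z.2 + 1))
  | loop {a b : Ty} (p : Prog a (.sum a b)) (x : a.val)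
      (D : PMF ((a.val ⊕ b.val) × ℕ)) (K : a.val → PMF (b.val × ℕ)) :
      Eval A V p x D →
      (∀ (y : a.val) (t : ℕ), (Sum.inl y, t) ∈ D.support → Eval A V (.loop p) y (K y)) →
      Eval A V (.loop p) x (D.bind fun o =>
        Sum.elim (fun y => (K y).map fun z => (z.1, o.2 + z.2 + 1))
          (fun z => PMF.pure (z, o.2 + 1)) o.1)

/-! ## Set systems, polytopes, negative dependence -/

/-- A submodular set function. -/
def Submodular {n : ℕ} (f : Finset (Fin n) → ℝ) : Prop :=
  ∀ S T, f (S ∪ T) + f (S ∩ T) ≤ f S + f T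

/-- The polytope of a set system: the convex hull of the indicator vectors of its maximal sets. -/
def polytope {n : ℕ} (I : Finset (Finset (Fin n))) : Set (Fin n → ℝ) :=
  convexHull ℝ {x | ∃ S, Maximal (· ∈ I) S ∧ x = fun i => if i ∈ S then (1 : ℝ) else 0}

/-- The probability of the event `E` under `D`. -/
noncomputable def prob {n : ℕ} (D : PMF (Finset (Fin n))) (E : Finset (Fin n) → Prop)
    [DecidablePred E] : ℝ :=
  ∑ S with E S, (D S).toReal

/-- The expectation of `g(S)` for `S ∼ D`. -/
noncomputable def expect {n : ℕ} (D : PMF (Finset (Fin n))) (g : Finset (Fin n) → ℝ) : ℝ :=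
  ∑ S, (D S).toReal * g S

/-- The expectation of `g(S)` for `S ∼ D` conditioned on the event `E` (of positive probability). -/
noncomputable def condExpect {n : ℕ} (D : PMF (Finset (Fin n))) (E : Finset (Fin n) → Prop)
    [DecidablePred E] (g : Finset (Fin n) → ℝ) : ℝ :=
  (∑ S with E S, (D S).toReal * g S) / prob D E

/-- Weak Negative Regression.  The condition on `i` is void when one of the two conditional
expectations is undefined. -/
def IsWNR {n : ℕ} (D : PMF (Finset (Fin n))) : Prop :=
  ∀ i : Fin n, 0 < prob D (fun S => i ∈ S) → 0 < prob D (fun S => i ∉ S) →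
    ∀ g : Finset (Fin n) → ℝ, Monotone g →
      condExpect D (fun S => i ∈ S) (fun S => g (S.erase i)) ≤
        condExpect D (fun S => i ∉ S) (fun S => g (S.erase i))

/-- `x` is the vector of marginals of `D`. -/
def HasMarginals {n : ℕ} (D : PMF (Finset (Fin n))) (x : Fin n → ℝ) : Prop :=
  ∀ i, prob D (fun S => i ∈ S) = x i

/-- `D` is a distribution over the set system `I`. -/
def SupportedOn {n : ℕ} (D : PMF (Finset (Fin n))) (I : Finset (Finset (Fin n))) : Prop :=
  ∀ S ∈ D.support, S ∈ I

/-! ## Efficient algorithms on classes of set systems -/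

/-- A set system on the ground set `{0, …, n - 1}`, together with the way it is presented to an
algorithm: a finite sequence of reals `desc` (part of the input, e.g. a list of edges or weights; it
may be empty), and an oracle (e.g. for membership; it may be constant). -/
structure Instance where
  n : ℕ
  sets : Finset (Finset (Fin n))
  desc : List ℝ
  oracle : List ℕ → ℝ

/-- The part of an algorithm's input that presents the set system: `n` and `desc`. -/
abbrev Ty.pres : Ty := .prod .nat (.list .real)

/-- The input that presents the set system. -/
def Instance.pres (X : Instance) : Ty.pres.val := (X.n, X.desc)

/-- The input size in which running times are measured. -/
def Instance.size (X : Instance) : ℕ := X.n + X.desc.length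

/-- The subset of `{0, …, n - 1}` listed by a list of numbers. -/
def toSet (n : ℕ) (l : List ℕ) : Finset (Fin n) := {i | (i : ℕ) ∈ l}

/-- The value oracle of a set function. -/
def valueOracle {n : ℕ} (f : Finset (Fin n) → ℝ) : List ℕ → ℝ := fun l => f (toSet n l)

/-- The distribution of the set returned by a program whose output and running time have joint
distribution `D`. -/
noncomputable def outSet (n : ℕ) (D : PMF (List ℕ × ℕ)) : PMF (Finset (Fin n)) :=
  D.map fun y => toSet n y.1

/-- Every run takes at most `T` steps. -/
def TimeAtMost {b : Ty} (D : PMF (b.val × ℕ)) (T : ℕ) : Prop :=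
  ∀ y ∈ D.support, y.2 ≤ T

/-- The polytopes of the set systems of the class are solvable: a randomised polynomial-time program
maximises every linear objective `c` over them. -/
def Solvable (C : Set Instance) : Prop :=
  ∃ (p : Prog (.prod .pres (.list .real)) (.list .real)) (P : Polynomial ℕ),
    p.NoValueQuery ∧
    ∀ X ∈ C, ∀ c : Fin X.n → ℝ, ∃ D : PMF (List ℝ × ℕ),
      Eval X.oracle (fun _ => 0) p (X.pres, List.ofFn c) D ∧
      TimeAtMost (b := .list .real) D (P.eval X.size) ∧
      ∀ y ∈ D.support, ∃ x ∈ polytope X.sets, y.1 = List.ofFn x ∧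
        ∀ z ∈ polytope X.sets, ∑ i, c i * z i ≤ ∑ i, c i * x i

/-- The set systems of the class efficiently admit WNR distributions: a randomised polynomial-time
program samples, for every point `x` of the polytope, from a WNR distribution over the set system
with marginals `x`. -/
def EfficientlyAdmitsWNR (C : Set Instance) : Prop :=
  ∃ (p : Prog (.prod .pres (.list .real)) (.list .nat)) (P : Polynomial ℕ),
    p.NoValueQuery ∧
    ∀ X ∈ C, ∀ x ∈ polytope X.sets, ∃ D : PMF (List ℕ × ℕ),
      Eval X.oracle (fun _ => 0) p (X.pres, List.ofFn x) D ∧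
      TimeAtMost (b := .list .nat) D (P.eval X.size) ∧
      SupportedOn (outSet X.n D) X.sets ∧
      IsWNR (outSet X.n D) ∧
      HasMarginals (outSet X.n D) x

end SubmodMax

/-! The algorithm is continuous greedy followed by one sample from the WNR distribution. Let `F` be
the multilinear extension of `f`, and put `m = n + 1`, `δ = 1 / m ^ 2`.

Rounding loses nothing (`Submodular.multilinear_le_expect`): a WNR distribution with marginals `x`
has expected value at least `F x` for every submodular `f`. Resampling one coordinate independently
cannot increase the expectation of a submodular function, because the marginal gain of an element is
antitone in the rest of the set and WNR correlates it favourably with the presence of that element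
(`Submodular.expect_mix_le`). Doing this for all coordinates in turn produces the product
distribution.

It remains to find `x` in the polytope with `F x` close to `(1 - 1 / e) f O`, where `O` is an
optimal maximal set. At a current point, the gradient of marginals paired with the indicator of `O`
is at least `f O - F x` (`Submodular.sub_multilinear_le`), so the best polytope direction does as
well, and a step of length `δ` realises at least the fraction `(1 - δ) ^ n` of this first-order gain
(`multilinear_add_step`). After `m ^ 2` steps the gap has shrunk by a factor of about `1 / e`, and
the final point is an average of polytope points.

The gradient is only estimated, by sums of `m ^ 4` samples. No concentration bound or failure event
is needed: the loss from optimising the wrong objective is bounded by a quadratic expression in the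
estimation error (`le_of_maximizer_of_estimate`), whose mean is controlled by the variance. Per step
this costs `B / m` in the target value, with `B = f O` in the nontrivial case. The expected gap is
then a supermartingale potential for the loop rule `Runs.forDown`, which handles distribution,
invariant and running time together. -/

namespace SubmodMax

/-! ## The multilinear extension -/

/-- The expected value of `f (S ∪ R)`, where `R` contains each element `i` of `L` independently with
probability `x i`. -/
def multilinear {α : Type*} [DecidableEq α] (x : α → ℝ) :
    List α → (Finset α → ℝ) → Finset α → ℝ
  | [], f, S => f S
  | i :: L, f, S => (1 - x i) * multilinear x L f S + x i * multilinear x L f (insert i S)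

section Multilinear

variable {α : Type*} [DecidableEq α] {x y : α → ℝ} {f g : Finset α → ℝ}

theorem multilinear_const (L : List α) (r : ℝ) (S : Finset α) :
    multilinear x L (fun _ => r) S = r := by
  induction L generalizing S with
  | nil => rfl
  | cons i L ih => simp only [multilinear, ih]; ring

theorem multilinear_add (L : List α) (S : Finset α) :
    multilinear x L (fun S => f S + g S) S = multilinear x L f S + multilinear x L g S := by
  induction L generalizing S with
  | nil => rfl
  | cons i L ih => simp only [multilinear, ih]; ring

theorem multilinear_const_mul (L : List α) (r : ℝ) (S : Finset α) :
    multilinear x L (fun S => r * f S) S = r * multilinear x L f S := by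
  induction L generalizing S with
  | nil => rfl
  | cons i L ih => simp only [multilinear, ih]; ring

theorem multilinear_sub (L : List α) (S : Finset α) :
    multilinear x L (fun S => f S - g S) S = multilinear x L f S - multilinear x L g S := by
  induction L generalizing S with
  | nil => rfl
  | cons i L ih => simp only [multilinear, ih]; ring

theorem multilinear_sum {ι : Type*} (L : List α) (s : Finset ι) (h : ι → Finset α → ℝ)
    (S : Finset α) :
    multilinear x L (fun S => ∑ j ∈ s, h j S) S = ∑ j ∈ s, multilinear x L (h j) S := by
  classical
  induction s using Finset.induction_on with
  | empty => simp [multilinear_const]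
  | insert a s ha ih => simp only [Finset.sum_insert ha, multilinear_add, ih]

theorem multilinear_le_multilinear (hx : ∀ i, 0 ≤ x i ∧ x i ≤ 1) (L : List α)
    (h : ∀ S, f S ≤ g S) (S : Finset α) : multilinear x L f S ≤ multilinear x L g S := by
  induction L generalizing S with
  | nil => exact h S
  | cons i L ih =>
    have h0 := (hx i).1
    have h1 : 0 ≤ 1 - x i := sub_nonneg.2 (hx i).2
    simp only [multilinear]
    gcongr <;> apply ih

theorem multilinear_monotone (hx : ∀ i, 0 ≤ x i ∧ x i ≤ 1) (L : List α) (hf : Monotone f) :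
    Monotone (multilinear x L f) := by
  induction L with
  | nil => exact hf
  | cons i L ih =>
    intro S T hST
    have h0 := (hx i).1
    have h1 : 0 ≤ 1 - x i := sub_nonneg.2 (hx i).2
    simp only [multilinear]
    gcongr
    · exact ih hST
    · exact ih (Finset.insert_subset_insert i hST)

theorem le_multilinear (hx : ∀ i, 0 ≤ x i ∧ x i ≤ 1) (L : List α) (hf : Monotone f)
    (S : Finset α) : f S ≤ multilinear x L f S := by
  induction L generalizing S with
  | nil => exact le_rfl
  | cons i L ih =>
    have h0 := (hx i).1
    have h1 : 0 ≤ 1 - x i := sub_nonneg.2 (hx i).2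
    have h2 := ih S
    have h3 := (hf (Finset.subset_insert i S)).trans (ih (insert i S))
    simp only [multilinear]
    nlinarith

theorem multilinear_mono_left (hx : ∀ i, 0 ≤ x i ∧ x i ≤ 1) (hy : ∀ i, 0 ≤ y i ∧ y i ≤ 1)
    (hxy : ∀ i, x i ≤ y i) (L : List α) (hf : Monotone f) (S : Finset α) :
    multilinear x L f S ≤ multilinear y L f S := by
  induction L generalizing S with
  | nil => exact le_rfl
  | cons i L ih =>
    have h0 := (hx i).1
    have h1 : 0 ≤ 1 - x i := sub_nonneg.2 (hx i).2
    have h2 := multilinear_monotone hy L hf (Finset.subset_insert i S)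
    simp only [multilinear]
    nlinarith [mul_le_mul_of_nonneg_left (ih S) h1,
      mul_le_mul_of_nonneg_left (ih (insert i S)) h0,
      mul_le_mul_of_nonneg_left h2 (sub_nonneg.2 (hxy i))]

theorem multilinear_insert (L : List α) (i : α) (S : Finset α) :
    multilinear x L (fun S => f (insert i S)) S = multilinear x L f (insert i S) := by
  induction L generalizing S with
  | nil => rfl
  | cons j L ih => simp only [multilinear, ih, Finset.insert_comm]

/-- The union of two independent random sets contains `i` with probability `1 - (1 - x i) * (1 - y
i)`, still independently over `i`. -/
theorem multilinear_multilinear (L : List α) (S : Finset α) :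
    multilinear x L (multilinear y L f) S =
      multilinear (fun i => 1 - (1 - x i) * (1 - y i)) L f S := by
  induction L generalizing S with
  | nil => rfl
  | cons i L ih =>
    have key : ∀ S, multilinear x L (multilinear y (i :: L) f) S =
        (1 - y i) * multilinear (fun i => 1 - (1 - x i) * (1 - y i)) L f S +
          y i * multilinear (fun i => 1 - (1 - x i) * (1 - y i)) L f (insert i S) := by
      intro S
      have : multilinear y (i :: L) f = fun S => (1 - y i) * multilinear y L f S +
          y i * multilinear y L f (insert i S) := rfl
      rw [this, multilinear_add, multilinear_const_mul, multilinear_const_mul,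
        multilinear_insert (f := multilinear y L f), ih, ih]
    rw [multilinear, key, key, Finset.insert_idem, multilinear]
    ring

/-- With probability at least `δ * v j * (1 - δ) ^ L.length` the element `j` is drawn and no other
one is; these events are disjoint, and elsewhere monotonicity keeps the value above `f S`.
Submodularity plays no role. -/
theorem add_marginals_le_multilinear {v : α → ℝ} (hv : ∀ i, 0 ≤ v i ∧ v i ≤ 1) {δ : ℝ}
    (hδ0 : 0 ≤ δ) (hδ1 : δ ≤ 1) (L : List α) (hf : Monotone f) (S : Finset α) :
    f S + (1 - δ) ^ L.length * δ * (L.map fun j => v j * (f (insert j S) - f S)).sum ≤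
      multilinear (fun i => δ * v i) L f S := by
  induction L with
  | nil => simp [multilinear]
  | cons i L ih =>
    have hv' : ∀ i, 0 ≤ δ * v i ∧ δ * v i ≤ 1 := fun i =>
      ⟨mul_nonneg hδ0 (hv i).1, mul_le_one₀ hδ1 (hv i).1 (hv i).2⟩
    have h0 : δ * v i ≤ δ := mul_le_of_le_one_right hδ0 (hv i).2
    have h1 := le_multilinear hv' L hf S
    have h2 := le_multilinear hv' L hf (insert i S)
    have h3 : 0 ≤ f (insert i S) - f S := sub_nonneg.2 (hf (Finset.subset_insert i S))
    have h4 : (1 - δ) ^ (L.length + 1) ≤ 1 := pow_le_one₀ (by linarith) (by linarith)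
    simp only [multilinear, List.length_cons, List.map_cons, List.sum_cons]
    set A := multilinear (fun i => δ * v i) L f S
    set s := (L.map fun j => v j * (f (insert j S) - f S)).sum
    have h5 : (1 - δ) * ((1 - δ) ^ L.length * δ * s) ≤ (1 - δ) * (A - f S) :=
      mul_le_mul_of_nonneg_left (by linarith) (by linarith)
    -- The branch without `i` keeps the gain of the tail and costs at most one factor `1 - δ`.
    have h6 : (1 - δ) * (A - f S) ≤ (1 - δ * v i) * (A - f S) :=
      mul_le_mul_of_nonneg_right (by linarith) (by linarith)
    have h7 : (1 - δ) ^ (L.length + 1) * (δ * v i * (f (insert i S) - f S)) ≤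
        1 * (δ * v i * (f (insert i S) - f S)) :=
      mul_le_mul_of_nonneg_right h4 (mul_nonneg (hv' i).1 h3)
    have h8 := mul_le_mul_of_nonneg_left h2 (hv' i).1
    have e1 : (1 - δ) ^ (L.length + 1) * δ * (v i * (f (insert i S) - f S) + s) =
        (1 - δ) ^ (L.length + 1) * (δ * v i * (f (insert i S) - f S)) +
          (1 - δ) * ((1 - δ) ^ L.length * δ * s) := by ring
    rw [e1]
    nlinarith

/-- A small step of size `δ` in direction `v` gains almost `δ` times the directional derivative. -/
theorem multilinear_add_step {v : α → ℝ} (hx : ∀ i, 0 ≤ x i ∧ x i ≤ 1)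
    (hv : ∀ i, 0 ≤ v i ∧ v i ≤ 1) {δ : ℝ} (hδ0 : 0 ≤ δ) (hδ1 : δ ≤ 1)
    (hxv : ∀ i, x i + δ * v i ≤ 1) [Fintype α] (L : List α) (hL : L.Nodup) (hL' : ∀ i, i ∈ L)
    (hf : Monotone f) (S : Finset α) :
    multilinear x L f S + (1 - δ) ^ L.length * δ *
        ∑ j, v j * multilinear x L (fun S => f (insert j S) - f S) S ≤
      multilinear (fun i => x i + δ * v i) L f S := by
  have hv' : ∀ i, 0 ≤ δ * v i ∧ δ * v i ≤ 1 := fun i =>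
    ⟨mul_nonneg hδ0 (hv i).1, mul_le_one₀ hδ1 (hv i).1 (hv i).2⟩
  have hsum : ∀ S, (L.map fun j => v j * (f (insert j S) - f S)).sum =
      ∑ j, v j * (f (insert j S) - f S) := by
    intro S
    rw [← List.sum_toFinset _ hL]
    congr 1
    ext i
    simp [hL']
  calc _ = multilinear x L (fun S => f S + (1 - δ) ^ L.length * δ *
        (L.map fun j => v j * (f (insert j S) - f S)).sum) S := by
        simp only [hsum, multilinear_add, multilinear_const_mul, multilinear_sum]
    _ ≤ multilinear x L (multilinear (fun i => δ * v i) L f) S :=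
        multilinear_le_multilinear hx L (add_marginals_le_multilinear hv hδ0 hδ1 L hf) S
    _ = _ := multilinear_multilinear L S
    -- Adding marginals dominates the union of independent samples: `1 - (1 - a) * (1 - b) ≤ a + b`.
    _ ≤ _ := by
        apply multilinear_mono_left _ _ _ L hf
        · intro i
          have h1 := mul_nonneg (sub_nonneg.2 (hx i).2) (sub_nonneg.2 (hv' i).2)
          have h2 := mul_le_one₀ (sub_le_self 1 (hx i).1) (sub_nonneg.2 (hv' i).2)
            (sub_le_self 1 (hv' i).1)
          constructor <;> linarith
        · exact fun i => ⟨add_nonneg (hx i).1 (hv' i).1, hxv i⟩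
        · intro i
          nlinarith [mul_nonneg (hx i).1 (hv' i).1]

end Multilinear

/-! ### Inequalities for marginal gains of submodular functions -/

section Submodular

variable {n : ℕ} {f : Finset (Fin n) → ℝ}

theorem Submodular.insert_sub_le (hf : Submodular f) {S T : Finset (Fin n)} (h : S ⊆ T)
    {i : Fin n} (hi : i ∉ T) : f (insert i T) - f T ≤ f (insert i S) - f S := by
  have h1 := hf (insert i S) T
  have e1 : insert i S ∪ T = insert i T := by
    rw [Finset.insert_union, Finset.union_eq_right.2 h]
  have e2 : insert i S ∩ T = S := by
    rw [Finset.insert_inter_of_notMem hi, Finset.inter_eq_left.2 h]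
  rw [e1, e2] at h1
  linarith

theorem Submodular.union_sub_le (hf : Submodular f) (hm : Monotone f) (O S : Finset (Fin n)) :
    f (O ∪ S) - f S ≤ ∑ j ∈ O, (f (insert j S) - f S) := by
  induction O using Finset.induction_on with
  | empty => simp
  | insert a O ha ih =>
    rw [Finset.sum_insert ha]
    have h1 := hf (insert a S) (O ∪ S)
    have e1 : insert a S ∪ (O ∪ S) = insert a O ∪ S := by ext; simp; tauto
    have h2 : f S ≤ f (insert a S ∩ (O ∪ S)) :=
      hm (Finset.subset_inter (Finset.subset_insert _ _) Finset.subset_union_right)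
    rw [e1] at h1
    linarith

/-- This bounds the range of a single gradient sample, and hence its variance. -/
theorem Submodular.insert_sub_le_singleton (hf : Submodular f) (h0 : ∀ S, 0 ≤ f S) (i : Fin n)
    (S : Finset (Fin n)) : f (insert i S) - f S ≤ f {i} := by
  have h1 := hf {i} S
  rw [← Finset.insert_eq] at h1
  linarith [h0 ({i} ∩ S)]

theorem Submodular.multilinear {x : Fin n → ℝ} (hx : ∀ i, 0 ≤ x i ∧ x i ≤ 1) (L : List (Fin n))
    (hf : Submodular f) : Submodular (multilinear x L f) := by
  induction L with
  | nil => exact hf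
  | cons i L ih =>
    intro S T
    have h0 := (hx i).1
    have h1 : 0 ≤ 1 - x i := sub_nonneg.2 (hx i).2
    have h2 := mul_le_mul_of_nonneg_left (ih S T) h1
    have h3 := mul_le_mul_of_nonneg_left (ih (insert i S) (insert i T)) h0
    rw [← Finset.insert_inter_distrib, ← Finset.insert_union_distrib] at h3
    simp only [SubmodMax.multilinear]
    linarith

/-! ## Weak negative regression implies submodular dominance -/

theorem sum_toReal_univ (D : PMF (Finset (Fin n))) : ∑ S, (D S).toReal = 1 := by
  have := D.tsum_coe
  rw [tsum_fintype] at this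
  rw [← ENNReal.toReal_sum (fun S _ => D.apply_ne_top S), this, ENNReal.toReal_one]

/-- The gain `h` of `i` does not depend on whether `i ∈ S` and is antitone, so WNR for `-h` says
that `h` is on average at least as large given `i ∈ S` as given `i ∉ S`. An independent copy of
coordinate `i` would collect only `x i` times the overall mean of `h`. -/
theorem Submodular.expect_mix_le {D : PMF (Finset (Fin n))} (hD : IsWNR D) {x : Fin n → ℝ}
    (hx : HasMarginals D x) (hf : Submodular f) (i : Fin n) :
    expect D (fun S => (1 - x i) * f (S.erase i) + x i * f (insert i S)) ≤ expect D f := by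
  set h : Finset (Fin n) → ℝ := fun S => f (insert i S) - f (S.erase i) with hh
  have herase : ∀ S, h (S.erase i) = h S := by
    intro S
    simp only [hh, Finset.erase_idem]
    by_cases hi : i ∈ S
    · rw [Finset.insert_erase hi, Finset.insert_eq_of_mem hi]
    · rw [Finset.erase_eq_of_notMem hi]
  have hanti : ∀ S T, S ⊆ T → h T ≤ h S := by
    intro S T hST
    have e : ∀ S : Finset (Fin n), insert i S = insert i (S.erase i) := by
      intro S; ext j; simp; tauto
    simp only [hh]
    rw [e T, e S]
    exact hf.insert_sub_le (Finset.erase_subset_erase i hST) (Finset.notMem_erase i T)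
  set A := ∑ S with i ∈ S, (D S).toReal * h S with hA
  set B := ∑ S with i ∉ S, (D S).toReal * h S with hB
  have htot := sum_toReal_univ D
  have hp : prob D (fun S => i ∈ S) = x i := hx i
  have hq : prob D (fun S => i ∉ S) = 1 - x i := by
    have := Finset.sum_filter_add_sum_filter_not Finset.univ (fun S : Finset (Fin n) => i ∈ S)
      (fun S => (D S).toReal)
    rw [htot] at this
    simp only [prob] at hp ⊢
    linarith
  have hp0 : 0 ≤ prob D (fun S => i ∈ S) := Finset.sum_nonneg fun _ _ => ENNReal.toReal_nonneg
  have hq0 : 0 ≤ prob D (fun S => i ∉ S) := Finset.sum_nonneg fun _ _ => ENNReal.toReal_nonneg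
  -- This is `B / (1 - x i) ≤ A / x i` with denominators cleared. WNR says nothing for marginals `0`
  -- and `1`, but then `A` or `B` is an empty contribution.
  have key : x i * (A + B) ≤ A := by
    rcases hp0.eq_or_lt with h1 | h1
    · have hA0 : A = 0 := by
        refine Finset.sum_eq_zero fun S hS => ?_
        have := (Finset.sum_eq_zero_iff_of_nonneg
          (fun _ _ => ENNReal.toReal_nonneg)).1 h1.symm S hS
        rw [this, zero_mul]
      rw [hp] at h1
      rw [← h1, hA0]; simp
    rcases hq0.eq_or_lt with h2 | h2
    · have hB0 : B = 0 := by
        refine Finset.sum_eq_zero fun S hS => ?_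
        have := (Finset.sum_eq_zero_iff_of_nonneg
          (fun _ _ => ENNReal.toReal_nonneg)).1 h2.symm S hS
        rw [this, zero_mul]
      rw [hq] at h2
      have : x i = 1 := by linarith
      rw [this, hB0]; simp
    have h3 := hD i h1 h2 (fun S => -h S) (fun S T hST => neg_le_neg (hanti S T hST))
    simp only [condExpect, herase, hp, hq, mul_neg, Finset.sum_neg_distrib] at h3
    rw [hp] at h1
    rw [hq] at h2
    rw [div_le_div_iff₀ h1 h2] at h3
    linarith
  have e1 : expect D f = expect D (fun S => f (S.erase i)) + A := by
    simp only [expect, hA, Finset.sum_filter, ← Finset.sum_add_distrib]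
    refine Finset.sum_congr rfl fun S _ => ?_
    split_ifs with hi
    · simp only [hh, Finset.insert_eq_of_mem hi]; ring
    · simp [Finset.erase_eq_of_notMem hi]
  have e2 : expect D (fun S => (1 - x i) * f (S.erase i) + x i * f (insert i S)) =
      expect D (fun S => f (S.erase i)) + x i * (A + B) := by
    rw [hA, hB, Finset.sum_filter_add_sum_filter_not]
    simp only [expect, Finset.mul_sum, ← Finset.sum_add_distrib, hh]
    refine Finset.sum_congr rfl fun S _ => ?_
    ring
  rw [e1, e2]
  linarith

/-- A hybrid argument: the coordinates in `L` are independent and the others come from `D`.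
Averaging over the independent part leaves a submodular function of `S`, so each exchange is an
instance of `Submodular.expect_mix_le` for the same `D`, and no conditional distribution has to be
WNR. -/
theorem Submodular.multilinear_le_expect {D : PMF (Finset (Fin n))} (hD : IsWNR D)
    {x : Fin n → ℝ} (hx : HasMarginals D x) (hx' : ∀ i, 0 ≤ x i ∧ x i ≤ 1) (hf : Submodular f)
    (L : List (Fin n)) (hL : L.Nodup) (hL' : ∀ i, i ∈ L) :
    SubmodMax.multilinear x L f ∅ ≤ expect D f := by
  have key : ∀ L : List (Fin n), L.Nodup →
      expect D (fun S => SubmodMax.multilinear x L f (S \ L.toFinset)) ≤ expect D f := by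
    intro L hL
    induction L with
    | nil => simp [SubmodMax.multilinear]
    | cons i L ih =>
      obtain ⟨hi, hL⟩ := List.nodup_cons.1 hL
      refine le_trans (le_trans (le_of_eq ?_) (Submodular.expect_mix_le hD hx
        (f := fun S => SubmodMax.multilinear x L f (S \ L.toFinset)) ?_ i)) (ih hL)
      · congr 1
        funext S
        have e1 : S \ (i :: L).toFinset = S.erase i \ L.toFinset := by
          ext j; simp; tauto
        have e2 : insert i (S.erase i \ L.toFinset) = insert i S \ L.toFinset := by
          ext j
          simp only [Finset.mem_insert, Finset.mem_sdiff, Finset.mem_erase, List.mem_toFinset]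
          by_cases hj : j = i
          · subst hj; simp [hi]
          · simp [hj]
        simp only [SubmodMax.multilinear, e1, e2]
      · intro S T
        have := (hf.multilinear hx' L) (S \ L.toFinset) (T \ L.toFinset)
        have e : S \ L.toFinset ∩ (T \ L.toFinset) = (S ∩ T) \ L.toFinset := by
          ext j; simp; tauto
        rwa [← Finset.union_sdiff_distrib, e] at this
  have h := key L hL
  have hLu : L.toFinset = Finset.univ := by ext i; simp [hL']
  have htot := sum_toReal_univ D
  have e : ∀ S : Finset (Fin n), S \ Finset.univ = ∅ := fun S => by ext; simp
  simpa only [hLu, e, expect, ← Finset.sum_mul, htot, one_mul] using h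

end Submodular

/-! ## Expectations under finitely supported distributions -/

/-- The expectation of `g` under `μ`. -/
noncomputable def mean {α : Type*} (μ : PMF α) (g : α → ℝ) : ℝ := ∑' a, (μ a).toReal * g a

section Mean

variable {α β : Type*} {μ : PMF α}

theorem mean_eq_sum (g : α → ℝ) {s : Finset α} (hs : μ.support ⊆ s) :
    mean μ g = ∑ a ∈ s, (μ a).toReal * g a := by
  refine tsum_eq_sum fun a ha => ?_
  have : μ a = 0 := by
    by_contra h
    exact ha (hs h)
  simp [this]

theorem sum_toReal_eq_one {s : Finset α} (hs : μ.support ⊆ s) : ∑ a ∈ s, (μ a).toReal = 1 := by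
  rw [← ENNReal.toReal_sum (fun a _ => μ.apply_ne_top a), ← ENNReal.toReal_one, ← μ.tsum_coe]
  congr 1
  refine (tsum_eq_sum fun a ha => ?_).symm
  by_contra h
  exact ha (hs h)

theorem mean_pure (a : α) (g : α → ℝ) : mean (PMF.pure a) g = g a := by
  rw [mean_eq_sum g (s := {a}) (by simp)]
  simp

theorem finite_support_pure (a : α) : (PMF.pure a).support.Finite := by simp

theorem finite_support_bind {κ : α → PMF β} (hμ : μ.support.Finite)
    (hκ : ∀ a ∈ μ.support, (κ a).support.Finite) : (μ.bind κ).support.Finite := by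
  rw [PMF.support_bind]
  exact hμ.biUnion hκ

theorem finite_support_map {k : α → β} (hμ : μ.support.Finite) : (μ.map k).support.Finite := by
  rw [PMF.support_map]
  exact hμ.image k

theorem mean_bind {κ : α → PMF β} (hμ : μ.support.Finite)
    (hκ : ∀ a ∈ μ.support, (κ a).support.Finite) (g : β → ℝ) :
    mean (μ.bind κ) g = mean μ fun a => mean (κ a) g := by
  classical
  have hb := finite_support_bind hμ hκ
  rw [mean_eq_sum g (s := hb.toFinset) (by simp),
    mean_eq_sum _ (s := hμ.toFinset) (by simp)]
  have h1 : ∀ b, ((μ.bind κ) b).toReal =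
      ∑ a ∈ hμ.toFinset, (μ a).toReal * (κ a b).toReal := by
    intro b
    rw [PMF.bind_apply, tsum_eq_sum (s := hμ.toFinset), ENNReal.toReal_sum]
    · simp [ENNReal.toReal_mul]
    · exact fun a _ => ENNReal.mul_ne_top (μ.apply_ne_top a) ((κ a).apply_ne_top b)
    · intro a ha
      have : μ a = 0 := by
        by_contra h
        exact ha (hμ.mem_toFinset.2 h)
      simp [this]
  simp only [h1, Finset.sum_mul]
  rw [Finset.sum_comm]
  refine Finset.sum_congr rfl fun a ha => ?_
  rw [mean_eq_sum g (μ := κ a) (s := hb.toFinset), Finset.mul_sum]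
  · simp only [mul_assoc]
  · intro b hb'
    simp only [Set.Finite.coe_toFinset, PMF.mem_support_bind_iff]
    exact ⟨a, hμ.mem_toFinset.1 ha, hb'⟩

theorem mean_map {k : α → β} (hμ : μ.support.Finite) (g : β → ℝ) :
    mean (μ.map k) g = mean μ fun a => g (k a) := by
  rw [← PMF.bind_pure_comp, mean_bind (κ := PMF.pure ∘ k) hμ (fun a _ => finite_support_pure (k a))]
  simp only [Function.comp, mean_pure]

theorem mean_mono (hμ : μ.support.Finite) {g h : α → ℝ} (hgh : ∀ a ∈ μ.support, g a ≤ h a) :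
    mean μ g ≤ mean μ h := by
  rw [mean_eq_sum g (s := hμ.toFinset) (by simp), mean_eq_sum h (s := hμ.toFinset) (by simp)]
  exact Finset.sum_le_sum fun a ha => mul_le_mul_of_nonneg_left
    (hgh a (hμ.mem_toFinset.1 ha)) ENNReal.toReal_nonneg

theorem mean_add (hμ : μ.support.Finite) (g h : α → ℝ) :
    mean μ (fun a => g a + h a) = mean μ g + mean μ h := by
  simp only [mean_eq_sum (μ := μ) _ (s := hμ.toFinset) (by simp), mul_add, Finset.sum_add_distrib]

theorem mean_const_mul (hμ : μ.support.Finite) (r : ℝ) (g : α → ℝ) :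
    mean μ (fun a => r * g a) = r * mean μ g := by
  simp only [mean_eq_sum (μ := μ) _ (s := hμ.toFinset) (by simp), Finset.mul_sum]
  exact Finset.sum_congr rfl fun a _ => by ring

theorem mean_const (hμ : μ.support.Finite) (r : ℝ) : mean μ (fun _ => r) = r := by
  rw [mean_eq_sum (μ := μ) _ (s := hμ.toFinset) (by simp), ← Finset.sum_mul,
    sum_toReal_eq_one (by simp), one_mul]

theorem mean_sub (hμ : μ.support.Finite) (g h : α → ℝ) :
    mean μ (fun a => g a - h a) = mean μ g - mean μ h := by
  have := mean_add hμ g (fun a => (-1) * h a)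
  rw [mean_const_mul hμ] at this
  simpa [sub_eq_add_neg] using this

/-- The cross term has mean zero, and the centred variable is at most `B` in absolute value.
Iterated, this bounds the variance of a sum of independent samples. -/
theorem mean_sq_sub_le (hμ : μ.support.Finite) {Y : α → ℝ} {B : ℝ}
    (hY : ∀ a ∈ μ.support, 0 ≤ Y a ∧ Y a ≤ B) (r : ℝ) :
    mean μ (fun a => (r + (Y a - mean μ Y)) ^ 2) ≤ r ^ 2 + B ^ 2 := by
  set m := mean μ Y with hm
  have hm0 : 0 ≤ m := by
    have := mean_mono hμ (g := fun _ => 0) (h := Y) fun a ha => (hY a ha).1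
    rwa [mean_const hμ] at this
  have hmB : m ≤ B := by
    have := mean_mono hμ (g := Y) (h := fun _ => B) fun a ha => (hY a ha).2
    rwa [mean_const hμ] at this
  have h1 : mean μ (fun a => (r + (Y a - m)) ^ 2) ≤
      mean μ (fun a => (r ^ 2 + B ^ 2) + 2 * r * (Y a - m)) := by
    refine mean_mono hμ fun a ha => ?_
    obtain ⟨h0, hB⟩ := hY a ha
    have : (Y a - m) ^ 2 ≤ B ^ 2 := sq_le_sq' (by linarith) (by linarith)
    nlinarith
  refine h1.trans (le_of_eq ?_)
  rw [mean_add hμ, mean_const hμ, mean_const_mul hμ, mean_sub hμ, mean_const hμ, ← hm]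
  ring

theorem expect_eq_mean {n : ℕ} (D : PMF (Finset (Fin n))) (g : Finset (Fin n) → ℝ) :
    expect D g = mean D g :=
  (mean_eq_sum g (by simp)).symm

theorem bind_congr_support {κ κ' : α → PMF β} (h : ∀ a ∈ μ.support, κ a = κ' a) :
    μ.bind κ = μ.bind κ' := by
  ext b
  simp only [PMF.bind_apply]
  refine tsum_congr fun a => ?_
  by_cases ha : μ a = 0
  · simp [ha]
  · rw [h a ha]

theorem eq_pure_of_support_subset {a : α} (h : ∀ b ∈ μ.support, b = a) : μ = PMF.pure a := by
  have h1 : ∀ b, b ≠ a → μ b = 0 := by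
    intro b hb
    by_contra h'
    exact hb (h b h')
  have h2 : μ a = 1 := by
    rw [← μ.tsum_coe, tsum_eq_single a h1]
  ext b
  by_cases hb : b = a
  · subst hb; simp [h2]
  · simp [h1 b hb, hb]

end Mean

theorem finite_support_coin (r : ℝ) : (coin r).support.Finite := Set.toFinite _

theorem mean_coin {r : ℝ} (h0 : 0 ≤ r) (h1 : r ≤ 1) (g : Unit ⊕ Unit → ℝ) :
    mean (coin r) g = r * g (Sum.inl ()) + (1 - r) * g (Sum.inr ()) := by
  rw [mean_eq_sum g (s := Finset.univ) (by simp)]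
  simp [coin, h0, h1]

/-! ## Running programs -/

section Runs

variable {A V : List ℕ → ℝ} {a b c d : Ty}

/-- Coins are the only source of randomness, so induction on the derivation gives finitely many
outcomes. All expectations are therefore finite sums, although the output types are infinite. -/
theorem Eval.finite_support {p : Prog a b} {x : a.val} {D : PMF (b.val × ℕ)}
    (h : Eval A V p x D) : D.support.Finite := by
  induction h with
  | prim | askSystem | askValue => exact finite_support_pure _
  | flip r => exact finite_support_map (finite_support_coin r)
  | comp p q x D K _ _ ih1 ih2 =>
    exact finite_support_bind ih1 fun y hy => finite_support_map (ih2 y hy)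
  | pair p q x D E _ _ ih1 ih2 =>
    exact finite_support_bind ih1 fun y hy => finite_support_map ih2
  | caseInl _ _ _ _ _ _ ih | caseInr _ _ _ _ _ _ ih => exact finite_support_map ih
  | loop p x D K _ _ ih1 ih2 =>
    refine finite_support_bind ih1 ?_
    rintro ⟨y | z, t⟩ hy
    · exact finite_support_map (ih2 y t hy)
    · exact finite_support_pure _

/-- The solver and the sampler are specified for a zero value oracle but get called where the oracle
answers for `f`. -/
theorem Eval.change_value {p : Prog a b} {x : a.val} {D : PMF (b.val × ℕ)}
    (h : Eval A V p x D) (hp : p.NoValueQuery) (V' : List ℕ → ℝ) : Eval A V' p x D := by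
  induction h with
  | prim o x => exact .prim o x
  | flip r => exact .flip r
  | askSystem l => exact .askSystem l
  | askValue l => exact hp.elim
  | comp p q x D K _ _ ih1 ih2 => exact .comp p q x D K (ih1 hp.1) fun y hy => ih2 y hy hp.2
  | pair p q x D E _ _ ih1 ih2 => exact .pair p q x D E (ih1 hp.1) (ih2 hp.2)
  | caseInl p q u w D _ ih => exact .caseInl p q u w D (ih hp.1)
  | caseInr p q u w D _ ih => exact .caseInr p q u w D (ih hp.2)
  | loop p x D K _ _ ih1 ih2 => exact .loop p x D K (ih1 hp) fun y t hy => ih2 y t hy hp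

/-- The program halts within `t` steps on every run, and its output has distribution `μ`. -/
def Runs (A V : List ℕ → ℝ) (p : Prog a b) (x : a.val) (μ : PMF b.val) (t : ℕ) : Prop :=
  ∃ D, Eval A V p x D ∧ D.map Prod.fst = μ ∧ ∀ y ∈ D.support, y.2 ≤ t

theorem Runs.finite {p : Prog a b} {x : a.val} {μ : PMF b.val} {t : ℕ} (h : Runs A V p x μ t) :
    μ.support.Finite := by
  obtain ⟨D, hD, rfl, -⟩ := h
  exact finite_support_map hD.finite_support

theorem Runs.mono {p : Prog a b} {x : a.val} {μ : PMF b.val} {t t' : ℕ} (h : Runs A V p x μ t)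
    (ht : t ≤ t') : Runs A V p x μ t' := by
  obtain ⟨D, hD, rfl, h⟩ := h
  exact ⟨D, hD, rfl, fun y hy => (h y hy).trans ht⟩

theorem Runs.prim (o : Prim a b) (x : a.val) : Runs A V (.prim o) x (PMF.pure (o.eval x)) 1 :=
  ⟨_, .prim o x, by simp [PMF.pure_map], by simp⟩

theorem Runs.flip (r : ℝ) : Runs A V .flip r (coin r) 1 :=
  ⟨_, .flip r, by rw [PMF.map_comp]; exact PMF.map_id _, by simp⟩

theorem Runs.askValue (l : List ℕ) : Runs A V .askValue l (PMF.pure (V l)) 1 :=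
  ⟨_, .askValue l, by simp [PMF.pure_map], by simp⟩

theorem Runs.comp {p : Prog a b} {q : Prog b c} {x : a.val} {μ : PMF b.val}
    {κ : b.val → PMF c.val} {t t' : ℕ} (hp : Runs A V p x μ t)
    (hq : ∀ y ∈ μ.support, Runs A V q y (κ y) t') :
    Runs A V (.comp p q) x (μ.bind κ) (t + t' + 1) := by
  classical
  obtain ⟨D, hD, rfl, ht⟩ := hp
  have hmem : ∀ y ∈ D.support, y.1 ∈ (D.map Prod.fst).support := fun y hy =>
    (PMF.mem_support_map_iff _ _ _).2 ⟨y, hy, rfl⟩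
  -- `Eval.comp` needs a continuation law for every value; off the support any distribution will do,
  -- and `E₀` supplies one.
  obtain ⟨y₀, hy₀⟩ := D.support_nonempty
  obtain ⟨E₀, -⟩ := hq y₀.1 (hmem y₀ hy₀)
  have : ∀ y, ∃ E : PMF (c.val × ℕ), y ∈ (D.map Prod.fst).support →
      Eval A V q y E ∧ E.map Prod.fst = κ y ∧ ∀ z ∈ E.support, z.2 ≤ t' := by
    intro y
    by_cases hy : y ∈ (D.map Prod.fst).support
    · obtain ⟨E, hE⟩ := hq y hy
      exact ⟨E, fun _ => hE⟩
    · exact ⟨E₀, fun h => (hy h).elim⟩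
  choose K hK using this
  refine ⟨_, .comp p q x D K hD fun y hy => (hK _ (hmem y hy)).1, ?_, ?_⟩
  · rw [PMF.map_bind, PMF.bind_map]
    refine bind_congr_support fun y hy => ?_
    rw [PMF.map_comp]
    exact (hK _ (hmem y hy)).2.1
  · intro z hz
    simp only [PMF.mem_support_bind_iff, PMF.mem_support_map_iff] at hz
    obtain ⟨y, hy, z, hz, rfl⟩ := hz
    have h1 := ht y hy
    have h2 := (hK _ (hmem y hy)).2.2 z hz
    simp only
    omega

theorem Runs.comp_pure {p : Prog a b} {q : Prog b c} {x : a.val} {y : b.val} {μ : PMF c.val}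
    {t t' : ℕ} (hp : Runs A V p x (PMF.pure y) t) (hq : Runs A V q y μ t') :
    Runs A V (.comp p q) x μ (t + t' + 1) := by
  have := Runs.comp (κ := fun _ => μ) hp (t' := t') (q := q) (by simpa using hq)
  rwa [PMF.pure_bind] at this

theorem Runs.comp_prim {p : Prog a b} (o : Prim b c) {x : a.val} {y : b.val}
    {t : ℕ} (hp : Runs A V p x (PMF.pure y) t) :
    Runs A V (.comp p (.prim o)) x (PMF.pure (o.eval y)) (t + 2) :=
  hp.comp_pure (.prim o y)

theorem Runs.comp_map {p : Prog a b} {q : Prog b c} {x : a.val} {μ : PMF b.val}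
    {k : b.val → c.val} {t t' : ℕ} (hp : Runs A V p x μ t)
    (hq : ∀ y ∈ μ.support, Runs A V q y (PMF.pure (k y)) t') :
    Runs A V (.comp p q) x (μ.map k) (t + t' + 1) := by
  rw [← PMF.bind_pure_comp]
  exact Runs.comp hp hq

theorem Runs.pair {p : Prog a b} {q : Prog a c} {x : a.val} {μ : PMF b.val}
    {ν : PMF c.val} {t t' : ℕ} (hp : Runs A V p x μ t) (hq : Runs A V q x ν t') :
    Runs A V (.pair p q) x (μ.bind fun y => ν.map fun z => (y, z)) (t + t' + 1) := by
  obtain ⟨D, hD, rfl, ht⟩ := hp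
  obtain ⟨E, hE, rfl, ht'⟩ := hq
  refine ⟨_, .pair p q x D E hD hE, ?_, ?_⟩
  · rw [PMF.map_bind, PMF.bind_map]
    refine bind_congr_support fun y hy => ?_
    rw [PMF.map_comp, Function.comp_apply, PMF.map_comp]
    rfl
  · intro z hz
    simp only [PMF.mem_support_bind_iff, PMF.mem_support_map_iff] at hz
    obtain ⟨y, hy, z, hz, rfl⟩ := hz
    have h1 := ht y hy
    have h2 := ht' z hz
    simp only
    omega

theorem Runs.pair_pure {p : Prog a b} {q : Prog a c} {x : a.val} {y : b.val}
    {z : c.val} {t t' : ℕ} (hp : Runs A V p x (PMF.pure y) t) (hq : Runs A V q x (PMF.pure z) t') :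
    Runs A V (.pair p q) x (PMF.pure (y, z)) (t + t' + 1) := by
  have := hp.pair hq
  rwa [PMF.pure_bind, PMF.pure_map] at this

theorem Runs.pair_right {p : Prog a b} {q : Prog a c} {x : a.val} {μ : PMF b.val}
    {z : c.val} {t t' : ℕ} (hp : Runs A V p x μ t) (hq : Runs A V q x (PMF.pure z) t') :
    Runs A V (.pair p q) x (μ.map fun y => (y, z)) (t + t' + 1) := by
  have := hp.pair hq
  simp only [PMF.pure_map] at this
  rw [← PMF.bind_pure_comp]
  exact this

theorem Runs.pair_left {p : Prog a b} {q : Prog a c} {x : a.val} {y : b.val}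
    {ν : PMF c.val} {t t' : ℕ} (hp : Runs A V p x (PMF.pure y) t) (hq : Runs A V q x ν t') :
    Runs A V (.pair p q) x (ν.map fun z => (y, z)) (t + t' + 1) := by
  have := hp.pair hq
  rwa [PMF.pure_bind] at this

theorem Runs.case_inl {p : Prog (.prod a c) d} {q : Prog (.prod b c) d} {u : a.val} {w : c.val}
    {μ : PMF d.val} {t : ℕ} (hp : Runs A V p (u, w) μ t) :
    Runs A V (.case p q) (Sum.inl u, w) μ (t + 1) := by
  obtain ⟨D, hD, rfl, ht⟩ := hp
  refine ⟨_, .caseInl p q u w D hD, ?_, ?_⟩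
  · rw [PMF.map_comp]; rfl
  · intro z hz
    simp only [PMF.mem_support_map_iff] at hz
    obtain ⟨y, hy, rfl⟩ := hz
    exact Nat.succ_le_succ (ht y hy)

theorem Runs.case_inr {p : Prog (.prod a c) d} {q : Prog (.prod b c) d} {u : b.val} {w : c.val}
    {μ : PMF d.val} {t : ℕ} (hq : Runs A V q (u, w) μ t) :
    Runs A V (.case p q) (Sum.inr u, w) μ (t + 1) := by
  obtain ⟨D, hD, rfl, ht⟩ := hq
  refine ⟨_, .caseInr p q u w D hD, ?_, ?_⟩
  · rw [PMF.map_comp]; rfl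
  · intro z hz
    simp only [PMF.mem_support_map_iff] at hz
    obtain ⟨y, hy, rfl⟩ := hz
    exact Nat.succ_le_succ (ht y hy)

/-- Every loop written below is a counted one, so whether a round exits is never random: this rule
and `Runs.loop_continue` suffice. -/
theorem Runs.loop_exit {p : Prog a (.sum a b)} {x : a.val} {z : b.val} {t : ℕ}
    (hp : Runs A V p x (PMF.pure (Sum.inr z)) t) :
    Runs A V (.loop p) x (PMF.pure z) (t + 1) := by
  obtain ⟨D, hD, hμ, ht⟩ := hp
  have hmem : ∀ y ∈ D.support, y.1 = Sum.inr z := by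
    intro y hy
    have : y.1 ∈ (D.map Prod.fst).support := (PMF.mem_support_map_iff _ _ _).2 ⟨y, hy, rfl⟩
    rw [hμ] at this
    simpa using this
  refine ⟨_, .loop p x D (fun _ => PMF.pure (z, 0)) hD ?_, ?_, ?_⟩
  · intro y t hy
    exact absurd (hmem _ hy) (by simp)
  · apply eq_pure_of_support_subset
    intro w hw
    simp only [PMF.mem_support_bind_iff, PMF.mem_support_map_iff] at hw
    obtain ⟨w, ⟨y, hy, hw⟩, rfl⟩ := hw
    rw [hmem y hy] at hw
    simp at hw
    simp [hw]
  · intro w hw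
    simp only [PMF.mem_support_bind_iff] at hw
    obtain ⟨y, hy, hw⟩ := hw
    rw [hmem y hy] at hw
    have := ht y hy
    simp at hw
    simp [hw, this]

theorem Runs.loop_continue {p : Prog a (.sum a b)} {x : a.val} {μ : PMF a.val}
    {κ : a.val → PMF b.val} {t t' : ℕ} (hp : Runs A V p x (μ.map Sum.inl) t)
    (hq : ∀ y ∈ μ.support, Runs A V (.loop p) y (κ y) t') :
    Runs A V (.loop p) x (μ.bind κ) (t + t' + 1) := by
  classical
  obtain ⟨D, hD, hμ, ht⟩ := hp
  have hmem : ∀ y ∈ D.support, ∃ u ∈ μ.support, y.1 = Sum.inl u := by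
    intro y hy
    have : y.1 ∈ (D.map Prod.fst).support := (PMF.mem_support_map_iff _ _ _).2 ⟨y, hy, rfl⟩
    rw [hμ, PMF.mem_support_map_iff] at this
    obtain ⟨u, hu, h⟩ := this
    exact ⟨u, hu, h.symm⟩
  obtain ⟨y₀, hy₀⟩ := μ.support_nonempty
  obtain ⟨E₀, -⟩ := hq y₀ hy₀
  have : ∀ y, ∃ E : PMF (b.val × ℕ), y ∈ μ.support →
      Eval A V (.loop p) y E ∧ E.map Prod.fst = κ y ∧ ∀ z ∈ E.support, z.2 ≤ t' := by
    intro y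
    by_cases hy : y ∈ μ.support
    · obtain ⟨E, hE⟩ := hq y hy
      exact ⟨E, fun _ => hE⟩
    · exact ⟨E₀, fun h => (hy h).elim⟩
  choose K hK using this
  refine ⟨_, .loop p x D K hD ?_, ?_, ?_⟩
  · intro y s hy
    obtain ⟨u, hu, h⟩ := hmem _ hy
    obtain rfl := Sum.inl.inj h
    exact (hK _ hu).1
  · have e : μ.bind κ = (D.map Prod.fst).bind
        (Sum.elim κ fun z => PMF.pure z) := by
      rw [hμ, PMF.bind_map]; rfl
    rw [e, PMF.map_bind, PMF.bind_map]
    refine bind_congr_support fun y hy => ?_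
    obtain ⟨u, hu, h⟩ := hmem _ hy
    simp only [h, Sum.elim_inl, Function.comp_apply]
    rw [PMF.map_comp]
    exact (hK _ hu).2.1
  · intro z hz
    simp only [PMF.mem_support_bind_iff] at hz
    obtain ⟨y, hy, hz⟩ := hz
    obtain ⟨u, hu, h⟩ := hmem _ hy
    simp only [h, Sum.elim_inl, PMF.mem_support_map_iff] at hz
    obtain ⟨z, hz, rfl⟩ := hz
    have h1 := ht y hy
    have h2 := (hK _ hu).2.2 z hz
    simp only
    omega

end Runs

/-! ## Program constructions -/

section Constructions

variable {A V : List ℕ → ℝ} {a b c s : Ty}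

/-- One round of `forDown`. -/
def forDownStep (body : Prog (.prod .nat (.prod c s)) s) :
    Prog (.prod .nat (.prod c s)) (.sum (.prod .nat (.prod c s)) s) :=
  .comp (.pair (.comp (.prim .fst) (.prim .natPred)) (.prim .snd))
    (.case (.comp (.comp (.prim .snd) (.prim .snd)) (.prim .inr))
      (.comp (.pair (.prim .fst) (.pair (.comp (.prim .snd) (.prim .fst)) body)) (.prim .inl)))

/-- Run the body for the indices `n - 1, …, 0`, on input `(n, (w, y))` with `w` a constant
environment and `y` the initial state. -/
def forDown (body : Prog (.prod .nat (.prod c s)) s) : Prog (.prod .nat (.prod c s)) s :=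
  .loop (forDownStep body)

/-- The loop rule: the invariant is preserved, and the potentials do not grow on average. -/
theorem Runs.forDown {ι : Type*} {body : Prog (.prod .nat (.prod c s)) s} {w : c.val} {n t : ℕ}
    (Inv : ℕ → s.val → Prop) (Φ : ι → ℕ → s.val → ℝ)
    (h : ∀ k < n, ∀ y, Inv (k + 1) y → ∃ μ, Runs A V body (k, (w, y)) μ t ∧
      (∀ z ∈ μ.support, Inv k z) ∧ ∀ i, mean μ (Φ i k) ≤ Φ i (k + 1) y)
    {y : s.val} (hy : Inv n y) :
    ∃ μ, Runs A V (SubmodMax.forDown body) (n, (w, y)) μ (n * (t + 20) + 20) ∧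
      (∀ z ∈ μ.support, Inv 0 z) ∧ ∀ i, mean μ (Φ i 0) ≤ Φ i n y := by
  induction n generalizing y with
  | zero =>
    refine ⟨PMF.pure y, ?_, by simpa using hy, fun i => (mean_pure _ _).le⟩
    have h1 : Runs A V (forDownStep body) (0, (w, y)) (PMF.pure (Sum.inr y)) 12 := by
      refine Runs.comp_pure (y := (Sum.inl (), (w, y))) (t := 5) (t' := 6)
        (((Runs.prim _ _).comp_prim _).pair_pure (Runs.prim _ _)) ?_
      exact Runs.case_inl (t := 5) (((Runs.prim _ _).comp_prim _).comp_prim _)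
    exact (Runs.loop_exit h1).mono (by omega)
  | succ n ih =>
    obtain ⟨μ, hμ, hInv, hΦ⟩ := h n (Nat.lt_succ_self n) y hy
    have h1 : Runs A V (forDownStep body) (n + 1, (w, y))
        ((μ.map fun z => (n, (w, z))).map Sum.inl) (t + 15) := by
      refine Runs.mono (t := 5 + (t + 9) + 1) ?_ (by omega)
      refine Runs.comp_pure (y := (Sum.inr n, (w, y))) (t := 5) (t' := t + 9)
        (((Runs.prim _ _).comp_prim _).pair_pure (Runs.prim _ _)) ?_
      refine Runs.case_inr (t := t + 8) ?_
      refine Runs.mono (t := (1 + (3 + t + 1) + 1) + 1 + 1) ?_ (by omega)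
      refine Runs.comp_map (t := 1 + (3 + t + 1) + 1) (t' := 1) ?_ fun z _ => Runs.prim .inl z
      have hw : Runs A V (.comp (.prim .snd) (.prim .fst) : Prog (.prod .nat (.prod c s)) c)
          (n, (w, y)) (PMF.pure w) 3 := (Runs.prim _ _).comp_prim _
      have hn : Runs A V (.prim .fst : Prog (.prod .nat (.prod c s)) .nat)
          (n, (w, y)) (PMF.pure n) 1 := Runs.prim _ _
      have h2 := hn.pair_left (hw.pair_left hμ)
      rw [PMF.map_comp] at h2
      exact h2
    have ih' := fun z (hz : Inv n z) => ih (fun k hk => h k (hk.trans (Nat.lt_succ_self n)))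
      (y := z) hz
    have : ∀ z, ∃ ν, z ∈ μ.support →
        Runs A V (SubmodMax.forDown body) (n, (w, z)) ν (n * (t + 20) + 20) ∧
        (∀ z ∈ ν.support, Inv 0 z) ∧ ∀ i, mean ν (Φ i 0) ≤ Φ i n z := by
      -- The body's guarantee holds only for reachable states, so `κ` takes an arbitrary value
      -- elsewhere.
      intro z
      by_cases hz : z ∈ μ.support
      · obtain ⟨ν, hν⟩ := ih' z (hInv z hz)
        exact ⟨ν, fun _ => hν⟩
      · exact ⟨PMF.pure z, fun h => (hz h).elim⟩
    choose κ hκ using this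
    refine ⟨μ.bind κ, ?_, ?_, ?_⟩
    · have h2 := Runs.loop_continue
        (κ := fun q : ℕ × (c.val × s.val) => κ q.2.2) h1 (t' := n * (t + 20) + 20) ?_
      · rw [PMF.bind_map] at h2
        exact h2.mono (by ring_nf; omega)
      · intro q hq
        rw [PMF.mem_support_map_iff] at hq
        obtain ⟨z, hz, rfl⟩ := hq
        exact (hκ z hz).1
    · intro z hz
      rw [PMF.mem_support_bind_iff] at hz
      obtain ⟨q, hq, hz⟩ := hz
      exact (hκ q hq).2.1 z hz
    · intro i
      rw [mean_bind hμ.finite fun z hz => (hκ z hz).1.finite]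
      exact (mean_mono hμ.finite fun z hz => (hκ z hz).2.2 i).trans (hΦ i)

theorem Runs.forDown_pure {body : Prog (.prod .nat (.prod c s)) s} {w : c.val} {n t : ℕ}
    (g : ℕ → s.val)
    (h : ∀ k < n, Runs A V body (k, (w, g (k + 1))) (PMF.pure (g k)) t) :
    Runs A V (SubmodMax.forDown body) (n, (w, g n)) (PMF.pure (g 0)) (n * (t + 20) + 20) := by
  obtain ⟨μ, h1, h2, -⟩ := Runs.forDown (A := A) (V := V) (body := body) (w := w) (n := n) (t := t)
    (ι := Empty) (fun k y => y = g k) (fun i => i.elim)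
    (by
      rintro k hk y rfl
      exact ⟨_, h k hk, by simp, fun i => i.elim⟩) rfl
  rwa [eq_pure_of_support_subset h2] at h1

/-- Multiplication of natural numbers. -/
def natMul : Prog (.prod .nat .nat) .nat :=
  .comp (.pair (.prim .fst) (.pair (.prim .snd) (.prim .natZero)))
    (forDown (.comp (.prim .snd) (.prim .natAdd)))

/-- Repeated addition takes time linear in the value of the first factor, which is affordable
because the factors used are polynomial in `n`. -/
theorem Runs.natMul (i j : ℕ) :
    Runs A V natMul (i, j) (PMF.pure (i * j)) (i * 23 + 30) := by
  have h := Runs.forDown_pure (A := A) (V := V) (s := .nat) (c := .nat)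
    (body := .comp (.prim .snd) (.prim .natAdd)) (w := j) (n := i) (t := 3)
    (fun k => (i - k) * j) ?_
  · simp only [Nat.sub_self, Nat.zero_mul, Nat.sub_zero] at h
    exact (Runs.comp_pure ((Runs.prim _ _).pair_pure ((Runs.prim _ _).pair_pure (Runs.prim _ _)))
      h).mono (by omega)
  · intro k hk
    have e : (i - k) * j = j + (i - (k + 1)) * j := by
      rw [show i - k = 1 + (i - (k + 1)) by omega]; ring
    rw [e]
    exact (Runs.prim _ _).comp_prim _

/-- `n ↦ (n + 1) ^ 2`. -/
def succSq : Prog .nat .nat :=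
  .comp (.pair (.prim .natSucc) (.prim .natSucc)) natMul

theorem Runs.succSq (n : ℕ) :
    Runs A V succSq n (PMF.pure ((n + 1) ^ 2)) ((n + 1) ^ 2 * 23 + 40) := by
  have h := Runs.comp_pure (Runs.pair_pure (A := A) (V := V) (Runs.prim .natSucc n)
    (Runs.prim .natSucc n)) (Runs.natMul (n + 1) (n + 1))
  rw [← pow_two] at h
  exact h.mono (by nlinarith)

/-- `n ↦ (n + 1) ^ 4`. -/
def succFourth : Prog .nat .nat :=
  .comp succSq (.comp (.pair (.prim .id) (.prim .id)) natMul)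

theorem Runs.succFourth (n : ℕ) :
    Runs A V succFourth n (PMF.pure ((n + 1) ^ 4)) ((n + 1) ^ 2 * 46 + 100) := by
  have h := (Runs.succSq (A := A) (V := V) n).comp_pure
    (Runs.comp_pure (Runs.pair_pure (Runs.prim .id _) (Runs.prim .id _))
      (Runs.natMul ((n + 1) ^ 2) ((n + 1) ^ 2)))
  rw [← pow_two, ← pow_mul] at h
  exact h.mono (by omega)

/-- The tail of a list. -/
def listTail : Prog (.list a) (.list a) :=
  .comp (.pair (.prim .uncons) (.prim .unit))
    (.case (.prim .nil) (.comp (.prim .fst) (.prim .snd)))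

theorem Runs.listTail (l : List a.val) : Runs A V (listTail (a := a)) l (PMF.pure l.tail) 8 := by
  refine Runs.comp_pure (t := 3) (t' := 4) ((Runs.prim _ _).pair_pure (Runs.prim _ _)) ?_
  cases l with
  | nil => exact (Runs.case_inl (Runs.prim _ _)).mono (by omega)
  | cons y l => exact Runs.case_inr ((Runs.prim _ _).comp_prim _)

/-- The head of a list of reals, or zero. -/
def realHead : Prog (.list .real) .real :=
  .comp (.pair (.prim .uncons) (.prim .unit))
    (.case (.comp (.prim .natZero) (.prim .natCast)) (.comp (.prim .fst) (.prim .fst)))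

theorem Runs.realHead (l : List ℝ) : Runs A V realHead l (PMF.pure (l.headD 0)) 8 := by
  refine Runs.comp_pure (t := 3) (t' := 4) ((Runs.prim _ _).pair_pure (Runs.prim _ _)) ?_
  cases l with
  | nil =>
    have h : Runs A V (.comp (.prim .natZero) (.prim .natCast) : Prog (.prod .unit .unit) .real)
        ((), ()) (PMF.pure ((0 : ℕ) : ℝ)) 3 := (Runs.prim _ _).comp_prim _
    rw [Nat.cast_zero] at h
    exact Runs.case_inl h
  | cons y l => exact Runs.case_inr ((Runs.prim _ _).comp_prim _)

/-- The entry of a list of reals at a given position. -/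
def realGet : Prog (.prod .nat (.list .real)) .real :=
  .comp (.comp (.pair (.prim .fst) (.pair (.prim .unit) (.prim .snd)))
    (forDown (.comp (.comp (.prim .snd) (.prim .snd)) listTail))) realHead

theorem Runs.realGet (i : ℕ) (l : List ℝ) :
    Runs A V realGet (i, l) (PMF.pure (l.getD i 0)) (i * 40 + 40) := by
  have h := Runs.forDown_pure (A := A) (V := V) (s := .list .real) (c := .unit)
    (body := .comp (.comp (.prim .snd) (.prim .snd)) SubmodMax.listTail) (w := ()) (n := i)
    (t := 12)
    (fun k => l.drop (i - k)) ?_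
  · simp only [Nat.sub_self, Nat.sub_zero, List.drop_zero] at h
    have e : l.getD i 0 = (l.drop i).headD 0 := by
      rw [List.headD_eq_head?_getD, List.head?_drop, List.getD_eq_getElem?_getD]
    rw [e]
    exact ((Runs.comp_pure ((Runs.prim _ _).pair_pure ((Runs.prim _ _).pair_pure (Runs.prim _ _)))
      h).comp_pure (Runs.realHead _)).mono (by omega)
  · intro k hk
    have e : l.drop (i - k) = (l.drop (i - (k + 1))).tail := by
      rw [List.tail_drop]; congr 1; omega
    rw [e]
    exact ((Runs.prim _ _).comp_prim _).comp_pure (Runs.listTail _)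

/-- The list of the values of a program at the indices `0, …, n - 1`. -/
def tabulate (p : Prog (.prod .nat c) .real) : Prog (.prod .nat c) (.list .real) :=
  .comp (.pair (.prim .fst) (.pair (.prim .snd) (.prim .nil)))
    (forDown (.comp (.pair (.comp (.pair (.prim .fst) (.comp (.prim .snd) (.prim .fst))) p)
      (.comp (.prim .snd) (.prim .snd))) (.prim .cons)))

theorem Runs.tabulate {p : Prog (.prod .nat c) .real} {w : c.val} {n t : ℕ} (Q : ℕ → ℝ → Prop)
    (φ : ℕ → ℝ → ℝ) (B : ℕ → ℝ)
    (h : ∀ i < n, ∃ μ, Runs A V p (i, w) μ t ∧ (∀ r ∈ μ.support, Q i r) ∧ mean μ (φ i) ≤ B i) :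
    ∃ μ, Runs A V (tabulate p) (n, w) μ (n * (t + 40) + 40) ∧
      (∀ l ∈ μ.support, l.length = n ∧ ∀ i < n, Q i (l.getD i 0)) ∧
      mean μ (fun l => ∑ i ∈ Finset.range n, φ i (l.getD i 0)) ≤ ∑ i ∈ Finset.range n, B i := by
  obtain ⟨μ, h1, h2, h3⟩ := Runs.forDown (A := A) (V := V) (s := .list .real)
    (body := .comp (.pair (.comp (.pair (.prim .fst) (.comp (.prim .snd) (.prim .fst))) p)
      (.comp (.prim .snd) (.prim .snd))) (.prim .cons)) (w := w) (n := n) (t := t + 20)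
    -- The indices run downwards and entries are consed, so `l` holds the entries `k, …, n - 1`,
    -- with entry `i` at position `i - k`. The potential counts actual costs for these and the
    -- bounds `B i` for those still missing.
    (ι := Unit) (fun k l => l.length + k = n ∧ ∀ i < n, k ≤ i → Q i (l.getD (i - k) 0))
    (fun _ k l => ∑ i ∈ Finset.range k, B i + ∑ i ∈ Finset.Ico k n, φ i (l.getD (i - k) 0))
    (by
      intro k hk l hl
      obtain ⟨μ, hμ, hQ, hφ⟩ := h k hk
      refine ⟨μ.map fun r => r :: l, ?_, ?_, ?_⟩
      · refine Runs.mono (t := (((1 + 3 + 1) + t + 1) + 3 + 1) + 1 + 1) ?_ (by omega)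
        have h2 : Runs A V (.pair (.comp (.pair (.prim .fst) (.comp (.prim .snd) (.prim .fst))) p)
            (.comp (.prim .snd) (.prim .snd))) (k, (w, l)) (μ.map fun r => (r, l))
            (((1 + 3 + 1) + t + 1) + 3 + 1) :=
          (Runs.comp_pure ((Runs.prim _ _).pair_pure ((Runs.prim _ _).comp_prim _)) hμ).pair_right
            ((Runs.prim _ _).comp_prim _)
        have h3 := h2.comp_map (q := .prim .cons) (k := fun q => q.1 :: q.2)
          fun z _ => Runs.prim .cons z
        rw [PMF.map_comp] at h3
        exact h3
      · intro z hz
        rw [PMF.mem_support_map_iff] at hz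
        obtain ⟨r, hr, rfl⟩ := hz
        refine ⟨by rw [List.length_cons]; omega, fun i hi hki => ?_⟩
        rcases hki.eq_or_lt with rfl | hlt
        · simpa using hQ r hr
        · have := hl.2 i hi hlt
          rw [show i - k = (i - (k + 1)) + 1 by omega, List.getD_cons_succ]
          exact this
      · intro _
        rw [mean_map hμ.finite]
        have e : ∀ r : ℝ, ∑ i ∈ Finset.range k, B i +
            ∑ i ∈ Finset.Ico k n, φ i ((r :: l).getD (i - k) 0) =
            φ k r + (∑ i ∈ Finset.range k, B i +
              ∑ i ∈ Finset.Ico (k + 1) n, φ i (l.getD (i - (k + 1)) 0)) := by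
          intro r
          rw [Finset.sum_eq_sum_Ico_succ_bot hk]
          have : ∑ i ∈ Finset.Ico (k + 1) n, φ i ((r :: l).getD (i - k) 0) =
              ∑ i ∈ Finset.Ico (k + 1) n, φ i (l.getD (i - (k + 1)) 0) := by
            refine Finset.sum_congr rfl fun i hi => ?_
            rw [Finset.mem_Ico] at hi
            rw [show i - k = (i - (k + 1)) + 1 by omega, List.getD_cons_succ]
          rw [this]
          simp
          ring
        simp only [e]
        rw [mean_add hμ.finite, mean_const hμ.finite, Finset.sum_range_succ]
        linarith)
    (y := []) ⟨by simp, fun i hi hi' => absurd hi' (by omega)⟩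
  refine ⟨μ, ?_, ?_, ?_⟩
  · exact (Runs.comp_pure ((Runs.prim _ _).pair_pure ((Runs.prim _ _).pair_pure (Runs.prim _ _)))
      h1).mono (by ring_nf; omega)
  · intro l hl
    obtain ⟨h4, h5⟩ := h2 l hl
    exact ⟨h4, fun i hi => h5 i hi (Nat.zero_le i)⟩
  · have := h3 ()
    simpa using this

theorem eq_ofFn_of_getD {n : ℕ} {l : List ℝ} {x : Fin n → ℝ} (hl : l.length = n)
    (h : ∀ i : Fin n, l.getD i 0 = x i) : l = List.ofFn x := by
  refine List.ext_getElem (by simp [hl]) fun i h1 h2 => ?_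
  have := h ⟨i, hl ▸ h1⟩
  simp only [List.getD_eq_getElem _ _ h1] at this
  simp [this]

theorem getD_ofFn {n : ℕ} (x : Fin n → ℝ) (i : Fin n) : (List.ofFn x).getD i 0 = x i := by
  rw [List.getD_eq_getElem _ _ (by simp)]
  simp

theorem Runs.tabulate_pure {p : Prog (.prod .nat c) .real} {w : c.val} {n t : ℕ} (x : Fin n → ℝ)
    (h : ∀ i : Fin n, Runs A V p ((i : ℕ), w) (PMF.pure (x i)) t) :
    Runs A V (SubmodMax.tabulate p) (n, w) (PMF.pure (List.ofFn x)) (n * (t + 40) + 40) := by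
  obtain ⟨μ, h1, h2, -⟩ := Runs.tabulate (A := A) (V := V) (p := p) (w := w) (n := n) (t := t)
    (fun i r => ∀ hi : i < n, r = x ⟨i, hi⟩) (fun _ _ => 0) (fun _ => 0)
    (fun i hi => ⟨_, h ⟨i, hi⟩, by simp, by simp [mean]⟩)
  rwa [eq_pure_of_support_subset (a := List.ofFn x) fun l hl =>
    eq_ofFn_of_getD (h2 l hl).1 fun i => (h2 l hl).2 i i.2 i.2] at h1

end Constructions

/-! ## Sampling and estimating the gradient -/

section Estimate

variable {A V : List ℕ → ℝ} {n : ℕ}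

/-- The elements `k - 1, …, 0` of the ground set. -/
def below (n : ℕ) : ℕ → List (Fin n)
  | 0 => []
  | k + 1 => if h : k < n then ⟨k, h⟩ :: below n k else below n k

theorem mem_below {k : ℕ} {i : Fin n} : i ∈ below n k ↔ (i : ℕ) < k := by
  induction k with
  | zero => simp [below]
  | succ k ih =>
    by_cases h : k < n
    · simp only [below, h, dite_true, List.mem_cons, ih, Fin.ext_iff]; omega
    · simp only [below, h, dite_false, ih]; omega

theorem nodup_below (k : ℕ) : (below n k).Nodup := by
  induction k with
  | zero => simp [below]
  | succ k ih =>
    by_cases h : k < n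
    · simp [below, h, ih, mem_below]
    · simpa [below, h] using ih

theorem length_below_self : (below n n).length = n := by
  have h : (below n n).toFinset = Finset.univ := by ext i; simp [mem_below]
  rw [← List.toFinset_card_of_nodup (nodup_below n), h, Finset.card_univ, Fintype.card_fin]

theorem toSet_cons {k : ℕ} (hk : k < n) (l : List ℕ) :
    toSet n (k :: l) = insert ⟨k, hk⟩ (toSet n l) := by
  ext i
  simp [toSet, Fin.ext_iff]

/-- One round of `sampleSet`. -/
def sampleStep : Prog (.prod .nat (.prod (.list .real) (.list .nat))) (.list .nat) :=
  .comp (.pair (.comp (.comp (.pair (.prim .fst) (.comp (.prim .snd) (.prim .fst))) realGet) .flip)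
      (.prim .id))
    (.case
      (.comp (.comp (.prim .snd) (.pair (.prim .fst) (.comp (.prim .snd) (.prim .snd))))
        (.prim .cons))
      (.comp (.comp (.prim .snd) (.prim .snd)) (.prim .snd)))

/-- Sample a set that contains the elements independently, with the given probabilities. -/
def sampleSet : Prog (.prod .nat (.list .real)) (.list .nat) :=
  .comp (.pair (.prim .fst) (.pair (.prim .snd) (.prim .nil))) (forDown sampleStep)

theorem Runs.sampleStep (k : ℕ) (xs : List ℝ) (R : List ℕ) :
    Runs A V sampleStep (k, (xs, R))
      ((coin (xs.getD k 0)).map fun o => Sum.elim (fun _ => k :: R) (fun _ => R) o)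
      (k * 40 + 70) := by
  have h1 : Runs A V (.pair (.comp (.comp (.pair (.prim .fst) (.comp (.prim .snd) (.prim .fst)))
        SubmodMax.realGet) .flip) (.prim .id) :
        Prog (.prod .nat (.prod (.list .real) (.list .nat)))
          (.prod .bool (.prod .nat (.prod (.list .real) (.list .nat)))))
      (k, (xs, R)) ((coin (xs.getD k 0)).map fun o => (o, (k, (xs, R))))
      (k * 40 + 50) :=
    Runs.mono ((Runs.comp_pure (Runs.comp_pure ((Runs.prim _ _).pair_pure
      ((Runs.prim _ _).comp_prim _)) (Runs.realGet k xs)) (Runs.flip _)).pair_right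
        (Runs.prim _ _)) (by omega)
  have h2 := h1.comp_map (k := fun q => Sum.elim (fun _ => k :: R) (fun _ => R) q.1) (t' := 12)
    (q := .case
      (.comp (.comp (.prim .snd) (.pair (.prim .fst) (.comp (.prim .snd) (.prim .snd))))
        (.prim .cons))
      (.comp (.comp (.prim .snd) (.prim .snd)) (.prim .snd))) ?_
  · rw [PMF.map_comp] at h2
    exact h2.mono (by omega)
  · intro q hq
    rw [PMF.mem_support_map_iff] at hq
    obtain ⟨o | o, ho, rfl⟩ := hq
    · exact (Runs.case_inl (((Runs.prim _ _).comp_pure ((Runs.prim _ _).pair_pure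
        ((Runs.prim _ _).comp_prim _))).comp_prim _)).mono (by omega)
    · exact (Runs.case_inr (((Runs.prim _ _).comp_prim _).comp_prim _)).mono (by omega)

theorem Runs.sampleSet {x : Fin n → ℝ} (hx : ∀ i, 0 ≤ x i ∧ x i ≤ 1) :
    ∃ μ, Runs A V sampleSet (n, List.ofFn x) μ (n * (n * 40 + 90) + 40) ∧
      ∀ g : Finset (Fin n) → ℝ,
        mean μ (fun R => g (toSet n R)) = multilinear x (below n n) g ∅ := by
  obtain ⟨μ, h1, -, h3⟩ := Runs.forDown (A := A) (V := V) (body := SubmodMax.sampleStep)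
    (w := List.ofFn x) (n := n) (t := n * 40 + 70) (ι := Finset (Fin n) → ℝ)
    -- The conditional expectation of `g` given the decisions so far, with the elements below `k`
    -- still undecided. Indexing the potentials by `g` yields one law that serves all `g`.
    (fun _ _ => True) (fun g k R => multilinear x (below n k) g (toSet n R))
    (by
      intro k hk R _
      refine ⟨_, (Runs.sampleStep k _ R).mono (by omega), fun _ _ => trivial, fun g => ?_⟩
      have e : (List.ofFn x).getD k 0 = x ⟨k, hk⟩ := getD_ofFn x ⟨k, hk⟩
      rw [mean_map (finite_support_coin _), e, mean_coin (hx _).1 (hx _).2]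
      simp only [Sum.elim_inl, Sum.elim_inr, toSet_cons hk, below, hk, dite_true, multilinear]
      linarith)
    (y := []) trivial
  refine ⟨μ, ?_, fun g => le_antisymm ?_ ?_⟩
  · exact (Runs.comp_pure ((Runs.prim _ _).pair_pure ((Runs.prim _ _).pair_pure (Runs.prim _ _)))
      h1).mono (by ring_nf; omega)
  · simpa [toSet, below, multilinear] using h3 g
  -- The loop rule gives inequalities in one direction only; applying it to `-g` turns them into an
  -- equality.
  · have h := h3 (fun S => (-1) * g S)
    simp only [multilinear_const_mul] at h
    rw [mean_const_mul h1.finite] at h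
    simp only [toSet, below, multilinear, List.not_mem_nil, Finset.filter_false] at h
    simp only [toSet]
    linarith

/-- Add `f (R ∪ {j}) - f R` for a random set `R` to the state; the environment is `(j, (n, x))`. -/
def estimateStep :
    Prog (.prod .nat (.prod (.prod .nat (.prod .nat (.list .real))) .real)) .real :=
  .comp (.pair (.prim .id) (.comp (.comp (.comp (.prim .snd) (.prim .fst)) (.prim .snd)) sampleSet))
    (.comp (.pair (.comp (.comp (.prim .fst) (.prim .snd)) (.prim .snd))
      (.comp (.pair
        (.comp (.comp (.pair
          (.comp (.comp (.comp (.prim .fst) (.prim .snd)) (.prim .fst)) (.prim .fst))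
          (.prim .snd)) (.prim .cons)) .askValue)
        (.comp (.prim .snd) .askValue)) (.prim .realSub))) (.prim .realAdd))

/-- On input `(j, (n, x))`, the sum of `(n + 1) ^ 4` independent samples of `f (R ∪ {j}) - f R`. -/
def estimate : Prog (.prod .nat (.prod .nat (.list .real))) .real :=
  .comp (.pair (.comp (.comp (.prim .snd) (.prim .fst)) succFourth)
      (.pair (.prim .id) (.comp (.prim .natZero) (.prim .natCast))))
    (forDown estimateStep)

/-- A bound on the running time of `estimate`. -/
def estimateTime (n : ℕ) : ℕ :=
  (n + 1) ^ 4 * (n * (n * 40 + 90) + 110) + 20 + (n + 1) ^ 2 * 46 + 120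

theorem Runs.estimateStep {f : Finset (Fin n) → ℝ} {x : Fin n → ℝ}
    {μ : PMF (List ℕ)} {t : ℕ}
    (hμ : Runs A (valueOracle f) SubmodMax.sampleSet (n, List.ofFn x) μ t)
    (j : Fin n) (k : ℕ) (r : ℝ) :
    Runs A (valueOracle f) estimateStep (k, (((j : ℕ), (n, List.ofFn x)), r))
      (μ.map fun R => r + (f (insert j (toSet n R)) - f (toSet n R))) (t + 50) := by
  have h1 : Runs A (valueOracle f)
      (.pair (.prim .id) (.comp (.comp (.comp (.prim .snd) (.prim .fst)) (.prim .snd))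
        SubmodMax.sampleSet) :
        Prog (.prod .nat (.prod (.prod .nat (.prod .nat (.list .real))) .real))
          (.prod (.prod .nat (.prod (.prod .nat (.prod .nat (.list .real))) .real)) (.list .nat)))
      (k, (((j : ℕ), (n, List.ofFn x)), r))
      (μ.map fun R => ((k, (((j : ℕ), (n, List.ofFn x)), r)), R)) (1 + (5 + t + 1) + 1) :=
    (Runs.prim _ _).pair_left ((((Runs.prim _ _).comp_prim _).comp_prim _).comp_pure hμ)
  have h2 := h1.comp_map (t' := 40)
    (k := fun q => q.1.2.2 + (f (insert j (toSet n q.2)) - f (toSet n q.2)))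
    (q := .comp (.pair (.comp (.comp (.prim .fst) (.prim .snd)) (.prim .snd))
      (.comp (.pair
        (.comp (.comp (.pair
          (.comp (.comp (.comp (.prim .fst) (.prim .snd)) (.prim .fst)) (.prim .fst))
          (.prim .snd)) (.prim .cons)) .askValue)
        (.comp (.prim .snd) .askValue)) (.prim .realSub))) (.prim .realAdd)) ?_
  · rw [PMF.map_comp] at h2
    exact h2.mono (by omega)
  · intro q hq
    rw [PMF.mem_support_map_iff] at hq
    obtain ⟨R, hR, rfl⟩ := hq
    have e : f (insert j (toSet n R)) = valueOracle f ((j : ℕ) :: R) := by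
      rw [valueOracle, toSet_cons j.2]
    simp only [e]
    refine Runs.mono (Runs.comp_prim .realAdd (Runs.pair_pure
      (((Runs.prim _ _).comp_prim _).comp_prim _) (Runs.comp_prim .realSub (Runs.pair_pure
        (Runs.comp_pure (Runs.comp_prim .cons (Runs.pair_pure
          ((((Runs.prim _ _).comp_prim _).comp_prim _).comp_prim _) (Runs.prim _ _)))
            (Runs.askValue _)) (Runs.comp_pure (Runs.prim _ _) (Runs.askValue _)))))) (by omega)

theorem Runs.estimate {f : Finset (Fin n) → ℝ} (hf : Monotone f) {x : Fin n → ℝ}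
    (hx : ∀ i, 0 ≤ x i ∧ x i ≤ 1) (j : Fin n) {B : ℝ} (hB : ∀ S, f (insert j S) - f S ≤ B) :
    ∃ μ, Runs A (valueOracle f) estimate ((j : ℕ), (n, List.ofFn x)) μ (estimateTime n) ∧
      mean μ (fun r => (r - (n + 1) ^ 4 *
        multilinear x (below n n) (fun S => f (insert j S) - f S) ∅) ^ 2) ≤
          (n + 1) ^ 4 * B ^ 2 := by
  obtain ⟨μ, hμ, hmean⟩ := Runs.sampleSet (A := A) (V := valueOracle f) hx
  set G := multilinear x (below n n) (fun S => f (insert j S) - f S) ∅ with hG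
  obtain ⟨ν, h1, -, h3⟩ := Runs.forDown (A := A) (V := valueOracle f)
    (body := SubmodMax.estimateStep) (w := ((j : ℕ), (n, List.ofFn x))) (n := (n + 1) ^ 4)
    (t := (n * (n * 40 + 90) + 40) + 50) (ι := Unit) (fun _ _ => True)
    -- With `k` samples outstanding: the squared deviation of the partial sum from its mean, plus a
    -- variance allowance `B ^ 2` for each outstanding sample.
    (fun _ k r => (r + k * G - (n + 1) ^ 4 * G) ^ 2 + k * B ^ 2)
    (by
      intro k hk r _
      refine ⟨_, Runs.estimateStep hμ j k r, fun _ _ => trivial, fun _ => ?_⟩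
      rw [mean_map hμ.finite, mean_add hμ.finite, mean_const hμ.finite]
      have hm := hmean (fun S => f (insert j S) - f S)
      have := mean_sq_sub_le hμ.finite
        (Y := fun R => f (insert j (toSet n R)) - f (toSet n R)) (B := B)
        (fun R _ => ⟨sub_nonneg.2 (hf (Finset.subset_insert _ _)), hB _⟩)
        (r + (k + 1) * G - (n + 1) ^ 4 * G)
      rw [hm, ← hG] at this
      push_cast
      refine le_trans (add_le_add_left (le_trans (le_of_eq ?_) this) _) (le_of_eq ?_)
      · congr 1
        funext R
        ring
      · ring)
    (y := ((0 : ℕ) : ℝ)) trivial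
  refine ⟨ν, ?_, ?_⟩
  · refine Runs.mono (Runs.comp_pure (Runs.pair_pure
      (Runs.comp_pure ((Runs.prim _ _).comp_prim _) (Runs.succFourth n))
      ((Runs.prim _ _).pair_pure ((Runs.prim _ _).comp_prim _))) h1) ?_
    rw [estimateTime]
    ring_nf
    omega
  · have := h3 ()
    simpa using this

/-- On input `(n, x)`, the list of the estimates for all elements. -/
def gradient : Prog (.prod .nat (.list .real)) (.list .real) :=
  .comp (.pair (.prim .fst) (.prim .id)) (tabulate estimate)

/-- Only errors on `J` are counted. An element that lies in no feasible set may have a singleton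
value far above the optimum, making its estimate useless, but such coordinates vanish on the
polytope. -/
theorem Runs.gradient {f : Finset (Fin n) → ℝ} (hf : Monotone f) (hf' : Submodular f)
    (h0 : ∀ S, 0 ≤ f S) {x : Fin n → ℝ} (hx : ∀ i, 0 ≤ x i ∧ x i ≤ 1) (J : Finset (Fin n))
    {B : ℝ} (hB : ∀ j ∈ J, f {j} ≤ B) :
    ∃ μ, Runs A (valueOracle f) gradient (n, List.ofFn x) μ (n * (estimateTime n + 40) + 50) ∧
      (∀ l ∈ μ.support, ∃ w : Fin n → ℝ, l = List.ofFn w) ∧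
      mean μ (fun l => ∑ j ∈ J, (l.getD j 0 - (n + 1) ^ 4 *
        multilinear x (below n n) (fun S => f (insert j S) - f S) ∅) ^ 2) ≤
          n * ((n + 1) ^ 4 * B ^ 2) := by
  set φ : ℕ → ℝ → ℝ := fun i r => if h : i < n then if (⟨i, h⟩ : Fin n) ∈ J then
      (r - (n + 1) ^ 4 *
        multilinear x (below n n) (fun S => f (insert ⟨i, h⟩ S) - f S) ∅) ^ 2 else 0 else 0 with hφ
  obtain ⟨μ, h1, h2, h3⟩ := Runs.tabulate (A := A) (V := valueOracle f)
    (p := SubmodMax.estimate) (w := (n, List.ofFn x)) (n := n) (t := estimateTime n)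
    (fun _ _ => True) φ (fun _ => (n + 1) ^ 4 * B ^ 2)
    (by
      intro i hi
      obtain ⟨μ, hμ, hm⟩ := Runs.estimate (A := A) hf hx ⟨i, hi⟩ (B := f {⟨i, hi⟩})
        (hf'.insert_sub_le_singleton h0 _)
      refine ⟨μ, hμ, fun _ _ => trivial, ?_⟩
      by_cases hJ : (⟨i, hi⟩ : Fin n) ∈ J
      · simp only [hφ, hi, hJ, dite_true, if_true]
        have h4 := h0 {⟨i, hi⟩}
        have h5 := hB _ hJ
        refine hm.trans ?_
        gcongr
      · simp only [hφ, hi, hJ, dite_true, if_false]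
        rw [mean_const hμ.finite]
        positivity)
  refine ⟨μ, ?_, ?_, ?_⟩
  · exact (Runs.comp_pure ((Runs.prim _ _).pair_pure (Runs.prim _ _)) h1).mono (by omega)
  · intro l hl
    exact ⟨fun i => l.getD i 0, eq_ofFn_of_getD (h2 l hl).1 fun i => rfl⟩
  · refine le_trans (le_of_eq ?_) (h3.trans (le_of_eq (by simp)))
    congr 1
    funext l
    rw [Finset.sum_range]
    simp [hφ, Finset.sum_ite_mem]

/-! ## Continuous greedy -/

/-- The body of `addScaled`. -/
def addScaledEntry :
    Prog (.prod .nat (.prod .nat (.prod (.list .real) (.list .real)))) .real :=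
  .comp (.pair
    (.comp (.pair (.prim .fst) (.comp (.comp (.prim .snd) (.prim .snd)) (.prim .fst))) realGet)
    (.comp (.pair
      (.comp (.pair (.prim .fst) (.comp (.comp (.prim .snd) (.prim .snd)) (.prim .snd))) realGet)
      (.comp (.comp (.comp (.prim .snd) (.prim .fst)) succSq) (.prim .natCast)))
      (.prim .realDiv))) (.prim .realAdd)

/-- On input `(n, (x, v))`, the vector `x + v / (n + 1) ^ 2`. -/
def addScaled : Prog (.prod .nat (.prod (.list .real) (.list .real))) (.list .real) :=
  .comp (.pair (.prim .fst) (.prim .id)) (tabulate addScaledEntry)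

/-- A bound on the running time of `addScaled`. -/
def addScaledTime (n : ℕ) : ℕ := n * (n * 80 + (n + 1) ^ 2 * 23 + 240) + 50

theorem Runs.addScaled (x v : Fin n → ℝ) :
    Runs A V addScaled (n, (List.ofFn x, List.ofFn v))
      (PMF.pure (List.ofFn fun i => x i + v i / (n + 1) ^ 2)) (addScaledTime n) := by
  have h := Runs.tabulate_pure (A := A) (V := V) (p := addScaledEntry)
    (w := (n, (List.ofFn x, List.ofFn v))) (fun i => x i + v i / (n + 1) ^ 2)
    (t := n * 80 + (n + 1) ^ 2 * 23 + 200) ?_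
  · exact (Runs.comp_pure ((Runs.prim _ _).pair_pure (Runs.prim _ _)) h).mono
      (by rw [addScaledTime]; ring_nf; omega)
  · intro i
    have e : x i + v i / (n + 1) ^ 2 =
        (List.ofFn x).getD i 0 + (List.ofFn v).getD i 0 / (((n + 1) ^ 2 : ℕ) : ℝ) := by
      rw [getD_ofFn, getD_ofFn]
      push_cast
      rfl
    rw [e]
    have hi := i.2
    refine Runs.mono (Runs.comp_prim .realAdd (Runs.pair_pure
      (Runs.comp_pure ((Runs.prim _ _).pair_pure (((Runs.prim _ _).comp_prim _).comp_prim _))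
        (Runs.realGet i _))
      (Runs.comp_prim .realDiv (Runs.pair_pure
        (Runs.comp_pure ((Runs.prim _ _).pair_pure (((Runs.prim _ _).comp_prim _).comp_prim _))
          (Runs.realGet i _))
        (Runs.comp_prim .natCast (Runs.comp_pure ((Runs.prim _ _).comp_prim _)
          (Runs.succSq n))))))) (by omega)

end Estimate

section Greedy

variable {A : List ℕ → ℝ} {n : ℕ}

/-- Since `v` beats `u` for `w / N`, it can lose for `G` at most the pairing of `u - v` with the
error `r = G - w / N`. Coordinatewise `|u - v| ≤ 1`, so this is at most `(r ^ 2 + s ^ 2) / (2 * s)`.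
Being linear in the squared errors, the bound survives taking means. The estimate `w` need not be
divided by `N`, as scaling leaves the maximisers unchanged. -/
theorem le_of_maximizer_of_estimate {G w v u : Fin n → ℝ} {J : Finset (Fin n)}
    (hv : ∀ i, 0 ≤ v i ∧ v i ≤ 1) (hu : ∀ i, 0 ≤ u i ∧ u i ≤ 1) (hvJ : ∀ i ∉ J, v i = 0)
    (huJ : ∀ i ∉ J, u i = 0) (hmax : ∑ i, w i * u i ≤ ∑ i, w i * v i) {N s : ℝ} (hN : 0 < N)
    (hs : 0 < s) :
    ∑ i, u i * G i - (∑ j ∈ J, (w j - N * G j) ^ 2 * (1 / (2 * N ^ 2 * s)) + n * (s / 2)) ≤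
      ∑ i, v i * G i := by
  have h1 : ∑ i, (u i - v i) * (G i - w i / N) ≤
      ∑ j ∈ J, ((w j - N * G j) ^ 2 * (1 / (2 * N ^ 2 * s)) + s / 2) := by
    rw [← Finset.sum_subset (Finset.subset_univ J)
      (fun i _ hi => by rw [hvJ i hi, huJ i hi]; ring)]
    refine Finset.sum_le_sum fun j _ => ?_
    obtain ⟨hv0, hv1⟩ := hv j
    obtain ⟨hu0, hu1⟩ := hu j
    have e : (w j - N * G j) ^ 2 * (1 / (2 * N ^ 2 * s)) + s / 2 =
        ((G j - w j / N) ^ 2 + s ^ 2) / (2 * s) := by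
      field_simp
      ring
    rw [e, le_div_iff₀ (by positivity)]
    set r := G j - w j / N
    have h2 : (u j - v j) ^ 2 ≤ 1 := by nlinarith
    nlinarith [sq_nonneg ((u j - v j) * s - r), mul_le_mul_of_nonneg_left h2 (sq_nonneg s)]
  have h2 : ∑ j ∈ J, ((w j - N * G j) ^ 2 * (1 / (2 * N ^ 2 * s)) + s / 2) ≤
      ∑ j ∈ J, (w j - N * G j) ^ 2 * (1 / (2 * N ^ 2 * s)) + n * (s / 2) := by
    rw [Finset.sum_add_distrib, Finset.sum_const, nsmul_eq_mul]
    have : (J.card : ℝ) ≤ n := by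
      have := Finset.card_le_univ J
      rw [Fintype.card_fin] at this
      exact_mod_cast this
    gcongr
  have h3 : ∑ i, (u i - v i) * (G i - w i / N) = ∑ i, u i * G i - ∑ i, v i * G i +
      (∑ i, w i * v i - ∑ i, w i * u i) / N := by
    simp only [← Finset.sum_sub_distrib, Finset.sum_div, ← Finset.sum_add_distrib]
    refine Finset.sum_congr rfl fun i _ => ?_
    ring
  have h4 : 0 ≤ (∑ i, w i * v i - ∑ i, w i * u i) / N :=
    div_nonneg (sub_nonneg.2 hmax) hN.le
  linarith

/-- For each outcome `R` of the random set, `f O - f R` is at most the sum of the gains over `R` of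
the elements of `O`; then average. -/
theorem Submodular.sub_multilinear_le {f : Finset (Fin n) → ℝ} (hf : Monotone f)
    (hf' : Submodular f) {x : Fin n → ℝ} (hx : ∀ i, 0 ≤ x i ∧ x i ≤ 1) (L : List (Fin n))
    (O S : Finset (Fin n)) :
    f O - SubmodMax.multilinear x L f S ≤ ∑ i, (if i ∈ O then (1 : ℝ) else 0) *
      SubmodMax.multilinear x L (fun S => f (insert i S) - f S) S := by
  have h : SubmodMax.multilinear x L (fun S => f O - f S) S ≤
      SubmodMax.multilinear x L (fun S => ∑ i ∈ O, (f (insert i S) - f S)) S :=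
    multilinear_le_multilinear hx L (fun S => (sub_le_sub_right
      (hf Finset.subset_union_left) _).trans (hf'.union_sub_le hf O S)) S
  rw [multilinear_sub, multilinear_const, multilinear_sum] at h
  simpa [Finset.sum_ite_mem] using h

/-- One step of continuous greedy, on input `(k, (presentation, x))`. -/
def greedyStep (p : Prog (.prod .pres (.list .real)) (.list .real)) :
    Prog (.prod .nat (.prod .pres (.list .real))) (.list .real) :=
  .comp (.pair (.comp (.comp (.prim .snd) (.prim .fst)) (.prim .fst))
    (.pair (.comp (.prim .snd) (.prim .snd))
      (.comp (.pair (.comp (.prim .snd) (.prim .fst))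
        (.comp (.pair (.comp (.comp (.prim .snd) (.prim .fst)) (.prim .fst))
          (.comp (.prim .snd) (.prim .snd))) gradient)) p))) addScaled

/-- A bound on the running time of `greedyStep`, for a solver with running time `t`. -/
def greedyStepTime (n t : ℕ) : ℕ := n * (estimateTime n + 40) + t + addScaledTime n + 100

theorem Runs.greedyStep_law {f : Finset (Fin n) → ℝ}
    {p : Prog (.prod .pres (.list .real)) (.list .real)} {desc : List ℝ} {t : ℕ} {x : Fin n → ℝ}
    {μ : PMF (List ℝ)} {κ : List ℝ → PMF (List ℝ)}
    (hμ : Runs A (valueOracle f) SubmodMax.gradient (n, List.ofFn x) μ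
      (n * (estimateTime n + 40) + 50))
    (hκ : ∀ w ∈ μ.support, Runs A (valueOracle f) p ((n, desc), w) (κ w) t)
    (hκ' : ∀ w ∈ μ.support, ∀ y ∈ (κ w).support, ∃ v : Fin n → ℝ, y = List.ofFn v) (k : ℕ) :
    Runs A (valueOracle f) (greedyStep p) (k, ((n, desc), List.ofFn x))
      ((μ.bind κ).map fun v => List.ofFn fun i : Fin n => x i + v.getD i 0 / (n + 1) ^ 2)
      (greedyStepTime n t) := by
  have h1 : Runs A (valueOracle f) (.pair (.comp (.prim .snd) (.prim .fst))
        (.comp (.pair (.comp (.comp (.prim .snd) (.prim .fst)) (.prim .fst))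
          (.comp (.prim .snd) (.prim .snd))) SubmodMax.gradient) :
        Prog (.prod .nat (.prod .pres (.list .real))) (.prod .pres (.list .real)))
      (k, ((n, desc), List.ofFn x)) (μ.map fun w => ((n, desc), w))
      (n * (estimateTime n + 40) + 70) :=
    Runs.mono (Runs.pair_left ((Runs.prim _ _).comp_prim _)
      (Runs.comp_pure (Runs.pair_pure (((Runs.prim _ _).comp_prim _).comp_prim _)
        ((Runs.prim _ _).comp_prim _)) hμ)) (by omega)
  have h2 := h1.comp (q := p) (κ := fun q => κ q.2) (t' := t) (by
    intro q hq
    rw [PMF.mem_support_map_iff] at hq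
    obtain ⟨w, hw, rfl⟩ := hq
    exact hκ w hw)
  rw [PMF.bind_map] at h2
  replace h2 : Runs (a := .prod .nat (.prod .pres (.list .real))) (b := .list .real) A
    (valueOracle f) _ (k, ((n, desc), List.ofFn x)) (μ.bind κ) _ := h2
  have h3 := Runs.pair_left (y := n)
    (p := (.comp (.comp (.prim .snd) (.prim .fst)) (.prim .fst) :
      Prog (.prod .nat (.prod .pres (.list .real))) .nat))
    (((Runs.prim _ _).comp_prim _).comp_prim _)
    (Runs.pair_left (y := List.ofFn x)
      (p := (.comp (.prim .snd) (.prim .snd) :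
        Prog (.prod .nat (.prod .pres (.list .real))) (.list .real)))
      ((Runs.prim _ _).comp_prim _) h2)
  rw [PMF.map_comp] at h3
  have h4 := h3.comp_map (q := SubmodMax.addScaled)
    (k := fun q => List.ofFn fun i : Fin n => x i + q.2.2.getD i 0 / (n + 1) ^ 2)
    (t' := addScaledTime n) (by
      intro q hq
      rw [PMF.mem_support_map_iff] at hq
      obtain ⟨y, hy, rfl⟩ := hq
      rw [PMF.mem_support_bind_iff] at hy
      obtain ⟨w, hw, hy⟩ := hy
      obtain ⟨v, rfl⟩ := hκ' w hw y hy
      have := Runs.addScaled (A := A) (V := valueOracle f) x v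
      simp only [Function.comp_apply, getD_ofFn]
      exact this)
  rw [PMF.map_comp] at h4
  exact h4.mono (by rw [greedyStepTime]; omega)

/-- The direction returned by the solver is compared with the indicator of `O`. The estimation error
lowers the target from `f O` to `f O - B / (n + 1)` on average, and the gap to this target
contracts. -/
theorem Runs.greedyStep {f : Finset (Fin n) → ℝ} (hf : Monotone f) (hf' : Submodular f)
    (h0 : ∀ S, 0 ≤ f S) {K : Set (Fin n → ℝ)} (hK : ∀ v ∈ K, ∀ i, 0 ≤ v i ∧ v i ≤ 1)
    {J : Finset (Fin n)} (hKJ : ∀ v ∈ K, ∀ i ∉ J, v i = 0) {O : Finset (Fin n)}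
    (hO : (fun i => if i ∈ O then (1 : ℝ) else 0) ∈ K) {B : ℝ} (hB0 : 0 < B)
    (hB : ∀ j ∈ J, f {j} ≤ B) {p : Prog (.prod .pres (.list .real)) (.list .real)}
    {desc : List ℝ} {t : ℕ}
    (hp : ∀ c : Fin n → ℝ, ∃ ν, Runs A (valueOracle f) p ((n, desc), List.ofFn c) ν t ∧
      ∀ y ∈ ν.support, ∃ v ∈ K, y = List.ofFn v ∧ ∀ z ∈ K, ∑ i, c i * z i ≤ ∑ i, c i * v i)
    {x : Fin n → ℝ} (hx : ∀ i, 0 ≤ x i ∧ x i ≤ 1)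
    (hxv : ∀ v ∈ K, ∀ i, x i + v i / (n + 1) ^ 2 ≤ 1) (k : ℕ) :
    ∃ μ, Runs A (valueOracle f) (greedyStep p) (k, ((n, desc), List.ofFn x)) μ
        (greedyStepTime n t) ∧
      (∀ z ∈ μ.support, ∃ v ∈ K, z = List.ofFn fun i => x i + v i / (n + 1) ^ 2) ∧
      multilinear x (below n n) f ∅ + (1 - 1 / ((n : ℝ) + 1) ^ 2) ^ n * (1 / (n + 1) ^ 2) *
          (f O - B / (n + 1) - multilinear x (below n n) f ∅) ≤
        mean μ (fun z => multilinear (fun i : Fin n => z.getD i 0) (below n n) f ∅) := by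
  obtain ⟨μ, hμ, hw, hm⟩ := Runs.gradient (A := A) hf hf' h0 hx J hB
  have : ∀ w, ∃ ν, w ∈ μ.support → Runs A (valueOracle f) p ((n, desc), w) ν t ∧
      ∀ y ∈ ν.support, ∃ v ∈ K, y = List.ofFn v ∧
        ∀ z ∈ K, ∑ i : Fin n, w.getD i 0 * z i ≤ ∑ i : Fin n, w.getD i 0 * v i := by
    intro w
    by_cases h : w ∈ μ.support
    · obtain ⟨c, rfl⟩ := hw w h
      obtain ⟨ν, hν⟩ := hp c
      simp only [getD_ofFn]
      exact ⟨ν, fun _ => hν⟩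
    · exact ⟨PMF.pure w, fun h' => (h h').elim⟩
  choose κ hκ using this
  have hlaw := Runs.greedyStep_law (k := k) hμ (fun w h => (hκ w h).1) fun w h y hy => by
    obtain ⟨v, -, e, -⟩ := (hκ w h).2 y hy
    exact ⟨v, e⟩
  refine ⟨_, hlaw, ?_, ?_⟩
  · intro z hz
    rw [PMF.mem_support_map_iff] at hz
    obtain ⟨y, hy, rfl⟩ := hz
    rw [PMF.mem_support_bind_iff] at hy
    obtain ⟨w, hw, hy⟩ := hy
    obtain ⟨v, hv, rfl, -⟩ := (hκ w hw).2 y hy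
    exact ⟨v, hv, by simp only [getD_ofFn]⟩
  have hκf : ∀ w ∈ μ.support, (κ w).support.Finite := fun w h => (hκ w h).1.finite
  rw [mean_map (finite_support_bind hμ.finite hκf), mean_bind hμ.finite hκf]
  simp only [getD_ofFn]
  set F := multilinear x (below n n) f ∅ with hF
  set G : Fin n → ℝ := fun j => multilinear x (below n n) (fun S => f (insert j S) - f S) ∅ with hG
  have hm0 : (0 : ℝ) < n + 1 := by positivity
  have hm1 : (1 : ℝ) ≤ n + 1 := by linarith [(Nat.cast_nonneg n : (0 : ℝ) ≤ n)]
  set m : ℝ := n + 1 with hmdef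
  have hδ1 : 1 / m ^ 2 ≤ 1 := by
    rw [div_le_one (by positivity)]
    exact one_le_pow₀ hm1
  set δ := 1 / m ^ 2 with hδ
  have hδ0 : 0 ≤ δ := by positivity
  set q := (1 - δ) ^ n * δ with hq
  have hq0 : 0 ≤ q := mul_nonneg (pow_nonneg (by linarith) _) hδ0
  -- This choice balances the two error terms: the mean quadratic error and `n * (s / 2)` are then
  -- both bounded by `n * B / (2 * m ^ 2)`.
  set s := B / m ^ 2 with hs
  have hs0 : 0 < s := by positivity
  set e := 1 / (2 * (m ^ 4) ^ 2 * s) with he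
  have key : ∀ w ∈ μ.support,
      (F + q * (f O - F - n * (s / 2))) +
        (-(q * e)) * (∑ j ∈ J, (w.getD j 0 - m ^ 4 * G j) ^ 2) ≤
      mean (κ w) fun y =>
        multilinear (fun i : Fin n => x i + y.getD i 0 / m ^ 2) (below n n) f ∅ := by
    intro w hw
    rw [← mean_const (hκf w hw) ((F + q * (f O - F - n * (s / 2))) +
        (-(q * e)) * (∑ j ∈ J, (w.getD j 0 - m ^ 4 * G j) ^ 2))]
    refine mean_mono (hκf w hw) fun y hy => ?_
    obtain ⟨v, hv, rfl, hmax⟩ := (hκ w hw).2 y hy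
    simp only [getD_ofFn]
    have h1 := multilinear_add_step (v := v) hx (hK v hv) hδ0 hδ1
      (fun i => by
        have := hxv v hv i
        rw [hδ, one_div_mul_eq_div]
        exact this) (below n n) (nodup_below n) (fun i => mem_below.2 i.2) hf ∅
    rw [length_below_self] at h1
    have h2 := le_of_maximizer_of_estimate (G := G) (hK v hv) (hK _ hO) (hKJ v hv) (hKJ _ hO)
      (hmax _ hO) (N := m ^ 4) (by positivity) hs0
    have h3 := hf'.sub_multilinear_le hf hx (below n n) O ∅
    have h4 : f O - F - (∑ j ∈ J, (w.getD j 0 - m ^ 4 * G j) ^ 2 * e + n * (s / 2)) ≤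
        ∑ i, v i * G i := by linarith
    have h5 := mul_le_mul_of_nonneg_left h4 hq0
    have h6 : (fun i => x i + δ * v i) = fun i => x i + v i / m ^ 2 := by
      funext i
      rw [hδ, one_div_mul_eq_div]
    rw [h6] at h1
    rw [← Finset.sum_mul] at h5
    linarith
  refine le_trans ?_ (mean_mono hμ.finite key)
  rw [mean_add hμ.finite, mean_const hμ.finite, mean_const_mul hμ.finite]
  have h7 : q * e * mean μ (fun w => ∑ j ∈ J, (w.getD j 0 - m ^ 4 * G j) ^ 2) ≤
      q * e * (n * (m ^ 4 * B ^ 2)) :=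
    mul_le_mul_of_nonneg_left hm (mul_nonneg hq0 (by positivity))
  have h8 : e * (n * (m ^ 4 * B ^ 2)) + n * (s / 2) ≤ B / m := by
    have : e * (n * (m ^ 4 * B ^ 2)) + n * (s / 2) = (n / m) * (B / m) := by
      rw [he, hs]
      field_simp
      ring
    rw [this]
    exact mul_le_of_le_one_left (by positivity) ((div_le_one hm0).2 (by linarith))
  have h9 := mul_le_mul_of_nonneg_left h8 hq0
  linarith

/-- Continuous greedy with `(n + 1) ^ 2` steps, for a given solver of linear problems. -/
def greedy (p : Prog (.prod .pres (.list .real)) (.list .real)) : Prog .pres (.list .real) :=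
  .comp (.pair (.comp (.prim .fst) succSq)
    (.pair (.prim .id) (.comp (.pair (.prim .fst) (.prim .unit))
      (tabulate (.comp (.prim .natZero) (.prim .natCast)))))) (forDown (greedyStep p))

/-- A bound on the running time of `greedy`, for a solver with running time `t`. -/
def greedyTime (n t : ℕ) : ℕ :=
  (n + 1) ^ 2 * (greedyStepTime n t + 20) + (n + 1) ^ 2 * 23 + n * 43 + 200

/-- Each step multiplies the expected gap by at most `1 - q`, and the initial gap is at most the
target since `F` is nonnegative at the origin. -/
theorem Runs.greedy {f : Finset (Fin n) → ℝ} (hf : Monotone f) (hf' : Submodular f)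
    (h0 : ∀ S, 0 ≤ f S) {K : Set (Fin n → ℝ)} (hKc : Convex ℝ K)
    (hK : ∀ v ∈ K, ∀ i, 0 ≤ v i ∧ v i ≤ 1)
    {J : Finset (Fin n)} (hKJ : ∀ v ∈ K, ∀ i ∉ J, v i = 0) {O : Finset (Fin n)}
    (hO : (fun i => if i ∈ O then (1 : ℝ) else 0) ∈ K) {B : ℝ} (hB0 : 0 < B)
    (hB : ∀ j ∈ J, f {j} ≤ B) {p : Prog (.prod .pres (.list .real)) (.list .real)}
    {desc : List ℝ} {t : ℕ}
    (hp : ∀ c : Fin n → ℝ, ∃ ν, Runs A (valueOracle f) p ((n, desc), List.ofFn c) ν t ∧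
      ∀ y ∈ ν.support, ∃ v ∈ K, y = List.ofFn v ∧ ∀ z ∈ K, ∑ i, c i * z i ≤ ∑ i, c i * v i) :
    ∃ μ, Runs A (valueOracle f) (greedy p) (n, desc) μ (greedyTime n t) ∧
      (∀ z ∈ μ.support, ∃ u ∈ K, z = List.ofFn u) ∧
      (f O - B / (n + 1)) - (1 - (1 - 1 / ((n : ℝ) + 1) ^ 2) ^ n * (1 / (n + 1) ^ 2)) ^
          ((n + 1) ^ 2) * (f O - B / (n + 1)) ≤
        mean μ (fun z => multilinear (fun i : Fin n => z.getD i 0) (below n n) f ∅) := by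
  have hm0 : (0 : ℝ) < n + 1 := by positivity
  have hm1 : (1 : ℝ) ≤ n + 1 := by linarith [(Nat.cast_nonneg n : (0 : ℝ) ≤ n)]
  have hδ1 : 1 / ((n : ℝ) + 1) ^ 2 ≤ 1 := by
    rw [div_le_one (by positivity)]
    exact one_le_pow₀ hm1
  have hδ0 : 0 ≤ 1 / ((n : ℝ) + 1) ^ 2 := by positivity
  set q := (1 - 1 / ((n : ℝ) + 1) ^ 2) ^ n * (1 / (n + 1) ^ 2) with hq
  have hq1 : q ≤ 1 := mul_le_one₀ (pow_le_one₀ (by linarith) (by linarith)) hδ0 hδ1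
  set M := f O - B / (n + 1)
  set F : List ℝ → ℝ := fun z => multilinear (fun i : Fin n => z.getD i 0) (below n n) f ∅ with hF
  have hT0 : (0 : ℝ) < (n + 1) ^ 2 := by positivity
  obtain ⟨μ, h1, h2, h3⟩ := Runs.forDown (A := A) (V := valueOracle f)
    (body := SubmodMax.greedyStep p) (w := (n, desc)) (n := (n + 1) ^ 2)
    (t := greedyStepTime n t) (ι := Unit)
    -- With `k` steps to go the iterate is a scaled-down point of `K`. It need not lie in `K`, which
    -- may not contain the origin; at `k = 0` the scaling factor is `1`.
    (fun k z => k ≤ (n + 1) ^ 2 ∧ ∃ u ∈ K,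
      z = List.ofFn fun i => (1 - k / (n + 1) ^ 2 : ℝ) * u i)
    -- Discounting the gap by the contraction still to come makes the potential nonincreasing in
    -- mean.
    (fun _ k z => (1 - q) ^ k * (M - F z))
    (by
      rintro k hk z ⟨-, u, hu, rfl⟩
      have hk' : ((k : ℝ) + 1) ≤ (n + 1) ^ 2 := by exact_mod_cast hk
      have hr0 : 0 ≤ 1 - ((k : ℝ) + 1) / (n + 1) ^ 2 := sub_nonneg.2 ((div_le_one hT0).2 hk')
      have hk0 : 0 ≤ (k : ℝ) / (n + 1) ^ 2 := by positivity
      have hsplit : 1 - ((k : ℝ) + 1) / (n + 1) ^ 2 =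
          (1 - (k : ℝ) / (n + 1) ^ 2) - 1 / (n + 1) ^ 2 := by ring
      have hs0 : 0 < 1 - (k : ℝ) / (n + 1) ^ 2 := by
        have : 0 < 1 / ((n : ℝ) + 1) ^ 2 := by positivity
        linarith
      push_cast
      obtain ⟨ν, hν, hsupp, hmean⟩ := Runs.greedyStep (A := A) hf hf' h0 hK hKJ hO hB0 hB hp
        (x := fun i => (1 - ((k : ℝ) + 1) / (n + 1) ^ 2) * u i)
        (fun i => ⟨mul_nonneg hr0 (hK u hu i).1, mul_le_one₀ (by
          have : 0 ≤ ((k : ℝ) + 1) / (n + 1) ^ 2 := by positivity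
          linarith) (hK u hu i).1 (hK u hu i).2⟩)
        (fun v hv i => by
          have e1 := mul_le_mul_of_nonneg_left (hK u hu i).2 hr0
          have e2 := mul_le_mul_of_nonneg_left (hK v hv i).2 hδ0
          rw [one_div_mul_eq_div] at e2
          linarith) k
      refine ⟨ν, hν, ?_, ?_⟩
      · intro z hz
        obtain ⟨v, hv, rfl⟩ := hsupp z hz
        -- The new point of `K` is the average of `u` and `v` with weights proportional to the mass
        -- already placed and to the new step.
        refine ⟨hk.le, _, hKc hu hv (div_nonneg hr0 hs0.le) (div_nonneg hδ0 hs0.le) ?_, ?_⟩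
        · rw [← add_div, div_eq_one_iff_eq hs0.ne']
          linarith
        · congr 1
          funext i
          simp only [Pi.add_apply, Pi.smul_apply, smul_eq_mul]
          rw [mul_add, ← mul_assoc, ← mul_assoc, mul_div_cancel₀ _ hs0.ne',
            mul_div_cancel₀ _ hs0.ne', one_div_mul_eq_div]
      · intro _
        rw [mean_const_mul hν.finite, mean_sub hν.finite, mean_const hν.finite, pow_succ,
          mul_assoc]
        refine mul_le_mul_of_nonneg_left ?_ (pow_nonneg (by linarith) _)
        simp only [hF, getD_ofFn]
        linarith)
    (y := List.ofFn fun _ : Fin n => (0 : ℝ))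
    -- The initial scaling factor is `0`, so any point of `K` serves as witness.
    ⟨le_rfl, _, hO, by
      push_cast
      rw [div_self hT0.ne']
      simp⟩
  refine ⟨μ, ?_, ?_, ?_⟩
  · have h4 := Runs.tabulate_pure (A := A) (V := valueOracle f) (c := .unit) (w := ())
      (p := .comp (.prim .natZero) (.prim .natCast)) (t := 3) (fun _ : Fin n => ((0 : ℕ) : ℝ))
      (fun i => (Runs.prim _ _).comp_prim _)
    rw [Nat.cast_zero] at h4
    refine Runs.mono (Runs.comp_pure (Runs.pair_pure (Runs.comp_pure (Runs.prim _ _)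
      (Runs.succSq n)) (Runs.pair_pure (Runs.prim _ _)
        (Runs.comp_pure ((Runs.prim _ _).pair_pure (Runs.prim _ _)) h4))) h1) ?_
    rw [greedyTime]
    omega
  · intro z hz
    obtain ⟨-, u, hu, rfl⟩ := h2 z hz
    exact ⟨u, hu, by simp⟩
  · have h5 := h3 ()
    simp only [pow_zero, one_mul] at h5
    rw [mean_sub h1.finite, mean_const h1.finite] at h5
    have h6 : 0 ≤ F (List.ofFn fun _ : Fin n => (0 : ℝ)) := by
      simp only [hF, getD_ofFn]
      exact (h0 ∅).trans (le_multilinear (fun _ => by simp) _ hf ∅)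
    have h7 : 0 ≤ (1 - q) ^ ((n + 1) ^ 2) := pow_nonneg (by linarith) _
    nlinarith [mul_nonneg h7 h6]

end Greedy

/-! ## The approximation algorithm -/

theorem mem_Icc_of_mem_polytope {n : ℕ} {I : Finset (Finset (Fin n))} {x : Fin n → ℝ}
    (hx : x ∈ polytope I) (i : Fin n) : 0 ≤ x i ∧ x i ≤ 1 := by
  have h : polytope I ⊆ {x | 0 ≤ x i ∧ x i ≤ 1} := by
    refine convexHull_min ?_ ?_
    · rintro _ ⟨S, -, rfl⟩
      by_cases h : i ∈ S <;> simp [h]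
    · exact (convex_Icc (0 : ℝ) 1).is_linear_preimage (f := fun x : Fin n → ℝ => x i)
        ⟨fun _ _ => rfl, fun _ _ => rfl⟩
  exact h hx

/-- Downward closure enters here: an element of any feasible set has a feasible singleton. -/
theorem eq_zero_of_mem_polytope {n : ℕ} {I : Finset (Finset (Fin n))}
    (hI : IsLowerSet (I : Set (Finset (Fin n)))) {x : Fin n → ℝ} (hx : x ∈ polytope I) {i : Fin n}
    (hi : {i} ∉ I) : x i = 0 := by
  have h : polytope I ⊆ {x | x i ∈ ({0} : Set ℝ)} := by
    refine convexHull_min ?_ ?_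
    · rintro _ ⟨S, hS, rfl⟩
      have : i ∉ S := fun h => hi (hI (Finset.singleton_subset_iff.2 h) hS.1)
      simp [this]
    · exact (convex_singleton (0 : ℝ)).is_linear_preimage (f := fun x : Fin n → ℝ => x i)
        ⟨fun _ _ => rfl, fun _ _ => rfl⟩
  exact h hx

/-- Run continuous greedy with the solver `p` and sample from the result with `q`. -/
def maximize (p : Prog (.prod .pres (.list .real)) (.list .real))
    (q : Prog (.prod .pres (.list .real)) (.list .nat)) : Prog .pres (.list .nat) :=
  .comp (.pair (.prim .id) (greedy p)) q

theorem Runs.maximize {A V : List ℕ → ℝ} {p : Prog (.prod .pres (.list .real)) (.list .real)}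
    {q : Prog (.prod .pres (.list .real)) (.list .nat)} {x : Ty.pres.val} {μ : PMF (List ℝ)}
    {κ : List ℝ → PMF (List ℕ)} {t t' : ℕ} (hp : Runs A V (SubmodMax.greedy p) x μ t)
    (hq : ∀ y ∈ μ.support, Runs A V q (x, y) (κ y) t') :
    Runs A V (SubmodMax.maximize p q) x (μ.bind κ) (t + t' + 3) := by
  have h1 := Runs.pair_left (Runs.prim (A := A) (V := V) .id x) hp
  have h2 := h1.comp (q := q) (κ := fun z => κ z.2) (t' := t') (by
    intro z hz
    rw [PMF.mem_support_map_iff] at hz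
    obtain ⟨y, hy, rfl⟩ := hz
    exact hq y hy)
  rw [PMF.bind_map] at h2
  exact h2.mono (by omega)

/-! ### Polynomial running time and the approximation loss -/

theorem exists_polynomial_greedyTime (P : Polynomial ℕ) :
    ∃ R : Polynomial ℕ, ∀ s, R.eval s = greedyTime s (P.eval s) := by
  set E : Polynomial ℕ := (.X + 1) ^ 4 * (.X * (.X * 40 + 90) + 110) + 20 + (.X + 1) ^ 2 * 46 + 120
  set S : Polynomial ℕ := .X * (.X * 80 + (.X + 1) ^ 2 * 23 + 240) + 50
  exact ⟨(.X + 1) ^ 2 * (.X * (E + 40) + P + S + 100 + 20) + (.X + 1) ^ 2 * 23 + .X * 43 + 200,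
    fun s => by simp [E, S, greedyTime, greedyStepTime, estimateTime, addScaledTime]⟩

theorem greedyTime_mono {n s : ℕ} (h : n ≤ s) (t : ℕ) : greedyTime n t ≤ greedyTime s t := by
  simp only [greedyTime, greedyStepTime, estimateTime, addScaledTime]
  gcongr

/-- The amount by which the approximation guarantee falls short of `1 - 1 / e`. -/
noncomputable def approxLoss (n : ℕ) : ℝ :=
  1 - 1 / Real.exp 1 -
    (1 - 1 / ((n : ℝ) + 1)) * (1 - Real.exp (-(1 - 1 / ((n : ℝ) + 1))))

theorem tendsto_approxLoss : Filter.Tendsto approxLoss Filter.atTop (nhds 0) := by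
  have h1 : Filter.Tendsto (fun n : ℕ => 1 - 1 / ((n : ℝ) + 1)) Filter.atTop (nhds (1 - 0)) :=
    tendsto_const_nhds.sub tendsto_one_div_add_atTop_nhds_zero_nat
  have h2 : Filter.Tendsto (fun n : ℕ => Real.exp (-(1 - 1 / ((n : ℝ) + 1)))) Filter.atTop
      (nhds (Real.exp (-(1 - 0)))) := (Real.continuous_exp.tendsto _).comp h1.neg
  have h3 := (tendsto_const_nhds (x := 1 - 1 / Real.exp 1)).sub (h1.mul (h2.const_sub 1))
  have e : 1 - 1 / Real.exp 1 - (1 - 0) * (1 - Real.exp (-(1 - 0))) = 0 := by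
    rw [sub_zero, Real.exp_neg]
    ring
  rw [e] at h3
  exact h3

/-- Bernoulli's inequality gives `r ≥ 1 - 1 / (n + 1)`, and `1 - t ≤ exp (-t)` bounds the `(n + 1) ^
2`-fold contraction by `exp (-r)`. -/
theorem approx_bound (n : ℕ) {M : ℝ} (hM : 0 ≤ M) :
    (1 - 1 / Real.exp 1 - approxLoss n) * M ≤
      (M - M / (n + 1)) - (1 - (1 - 1 / ((n : ℝ) + 1) ^ 2) ^ n * (1 / (n + 1) ^ 2)) ^
          ((n + 1) ^ 2) * (M - M / (n + 1)) := by
  have hn : (0 : ℝ) ≤ n := Nat.cast_nonneg n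
  have hm0 : (0 : ℝ) < n + 1 := by positivity
  have hδ1 : 1 / ((n : ℝ) + 1) ^ 2 ≤ 1 := by
    rw [div_le_one (by positivity)]
    exact one_le_pow₀ (by linarith)
  have hδ0 : 0 ≤ 1 / ((n : ℝ) + 1) ^ 2 := by positivity
  set r := (1 - 1 / ((n : ℝ) + 1) ^ 2) ^ n with hr
  have h1 : 1 - 1 / ((n : ℝ) + 1) ≤ r := by
    have h := one_add_mul_le_pow (a := -(1 / ((n : ℝ) + 1) ^ 2)) (by linarith) n
    rw [← sub_eq_add_neg] at h
    refine le_trans ?_ h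
    have : (n : ℝ) * (1 / (n + 1) ^ 2) ≤ 1 / (n + 1) := by
      rw [mul_one_div, div_le_div_iff₀ (by positivity) hm0]
      nlinarith
    linarith
  have hr1 : r ≤ 1 := pow_le_one₀ (by linarith) (by linarith)
  have h2 : (1 - r * (1 / (n + 1) ^ 2)) ^ ((n + 1) ^ 2) ≤
      Real.exp (-(1 - 1 / ((n : ℝ) + 1))) := by
    have h3 : 1 - r * (1 / ((n : ℝ) + 1) ^ 2) ≤ Real.exp (-(r * (1 / (n + 1) ^ 2))) := by
      linarith [Real.add_one_le_exp (-(r * (1 / ((n : ℝ) + 1) ^ 2)))]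
    have h4 : 0 ≤ 1 - r * (1 / ((n : ℝ) + 1) ^ 2) :=
      sub_nonneg.2 (mul_le_one₀ hr1 hδ0 hδ1)
    refine (pow_le_pow_left₀ h4 h3 _).trans ?_
    rw [← Real.exp_nat_mul, Real.exp_le_exp]
    push_cast
    rw [show ((n : ℝ) + 1) ^ 2 * -(r * (1 / (n + 1) ^ 2)) = -r by field_simp]
    linarith
  have h5 : M - M / (n + 1) = (1 - 1 / ((n : ℝ) + 1)) * M := by ring
  have h6 : 0 ≤ (1 - 1 / ((n : ℝ) + 1)) * M :=
    mul_nonneg (sub_nonneg.2 ((div_le_one hm0).2 (by linarith))) hM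
  rw [h5, approxLoss]
  nlinarith [mul_le_mul_of_nonneg_right h2 h6]

end SubmodMax

/-! ### The main theorem -/

open SubmodMax in
theorem theorem1p7 :
    ∃ ε : ℕ → ℝ, Filter.Tendsto ε Filter.atTop (nhds 0) ∧
      ∀ C : Set Instance,
        (∀ X ∈ C, IsLowerSet (X.sets : Set (Finset (Fin X.n)))) →
        Solvable C →
        EfficientlyAdmitsWNR C →
        ∃ (p : Prog .pres (.list .nat)) (P : Polynomial ℕ),
          ∀ X ∈ C, ∀ f : Finset (Fin X.n) → ℝ,
            (∀ S, 0 ≤ f S) → Monotone f → Submodular f →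
            ∃ D : PMF (List ℕ × ℕ),
              Eval X.oracle (valueOracle f) p X.pres D ∧
              TimeAtMost (b := .list .nat) D (P.eval X.size) ∧
              SupportedOn (outSet X.n D) X.sets ∧
              ∀ M : ℝ, IsGreatest (f '' (X.sets : Set (Finset (Fin X.n)))) M →
                (1 - 1 / Real.exp 1 - ε X.n) * M ≤ expect (outSet X.n D) f := by
  refine ⟨approxLoss, tendsto_approxLoss, fun C hC => ?_⟩
  rintro ⟨p, P, hpV, hp⟩ ⟨q, Q, hqV, hq⟩
  obtain ⟨R, hR⟩ := exists_polynomial_greedyTime P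
  refine ⟨maximize p q, R + Q + 3, fun X hX f h0 hf hf' => ?_⟩
  have hlow := hC X hX
  -- Feasibility of some set follows from solvability: the solver returns a point of the polytope.
  obtain ⟨S₀, hS₀⟩ : X.sets.Nonempty := by
    obtain ⟨D, -, -, h⟩ := hp X hX 0
    obtain ⟨y, hy⟩ := D.support_nonempty
    obtain ⟨x, hx, -⟩ := h y hy
    obtain ⟨_, S, hS, -⟩ := convexHull_nonempty_iff.1 ⟨x, hx⟩
    exact ⟨S, hS.1⟩
  obtain ⟨O₁, hO₁, hmax⟩ := X.sets.exists_max_image f ⟨S₀, hS₀⟩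
  -- Only maximal sets are vertices in the definition of the polytope; monotonicity lets an optimum
  -- be enlarged to one.
  obtain ⟨O, hO₁O, hO⟩ := X.sets.exists_le_maximal hO₁
  have hgreat : IsGreatest (f '' (X.sets : Set (Finset (Fin X.n)))) (f O) := by
    refine ⟨⟨O, hO.1, rfl⟩, ?_⟩
    rintro _ ⟨S, hS, rfl⟩
    exact (hmax S hS).trans (hf hO₁O)
  -- The error analysis divides by `B`, hence the value `1` when the optimum is `0`, where the
  -- guarantee is trivial.
  set B := if f O = 0 then 1 else f O with hBdef
  have hB0 : 0 < B := by
    rw [hBdef]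
    split_ifs with h
    · exact one_pos
    · exact lt_of_le_of_ne (h0 O) (Ne.symm h)
  have hBO : f O ≤ B := by
    rw [hBdef]
    split_ifs with h
    · rw [h]; exact zero_le_one
    · exact le_rfl
  obtain ⟨μ, hμ, hsupp, hmean⟩ := Runs.greedy (A := X.oracle) hf hf' h0
    (K := polytope X.sets) (convex_convexHull ℝ _) (fun v hv => mem_Icc_of_mem_polytope hv)
    (J := Finset.univ.filter fun i => {i} ∈ X.sets)
    (fun v hv i hi => eq_zero_of_mem_polytope hlow hv (by simpa using hi)) (O := O)
    (subset_convexHull ℝ _ ⟨O, hO, rfl⟩) hB0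
    (fun j hj => (hgreat.2 ⟨{j}, (Finset.mem_filter.1 hj).2, rfl⟩).trans hBO) (p := p)
    (desc := X.desc) (t := P.eval X.size)
    (fun c => by
      obtain ⟨D, hD, hDt, hDx⟩ := hp X hX c
      refine ⟨_, ⟨D, hD.change_value hpV _, rfl, hDt⟩, fun y hy => ?_⟩
      rw [PMF.mem_support_map_iff] at hy
      obtain ⟨y, hy, rfl⟩ := hy
      obtain ⟨v, hv, e, h⟩ := hDx y hy
      exact ⟨v, hv, e, h⟩)
  have : ∀ z, ∃ ν : PMF (List ℕ), z ∈ μ.support →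
      Runs X.oracle (valueOracle f) q (X.pres, z) ν (Q.eval X.size) ∧
      SupportedOn (ν.map (toSet X.n)) X.sets ∧
      multilinear (fun i : Fin X.n => z.getD i 0) (below X.n X.n) f ∅ ≤
        mean ν (fun l => f (toSet X.n l)) := by
    intro z
    by_cases hz : z ∈ μ.support
    · obtain ⟨u, hu, rfl⟩ := hsupp z hz
      obtain ⟨D, hD, hDt, hDs, hDw, hDm⟩ := hq X hX u hu
      have hD' := hD.change_value hqV (valueOracle f)
      have e : outSet X.n D = (D.map Prod.fst).map (toSet X.n) := by
        rw [PMF.map_comp]; rfl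
      refine ⟨D.map Prod.fst, fun _ => ⟨⟨D, hD', rfl, hDt⟩, ?_, ?_⟩⟩
      · rwa [← e]
      · rw [← mean_map (finite_support_map hD.finite_support), ← e, ← expect_eq_mean]
        simp only [getD_ofFn]
        exact hf'.multilinear_le_expect hDw hDm (fun i => mem_Icc_of_mem_polytope hu i)
          _ (nodup_below _) fun i => mem_below.2 i.2
    · exact ⟨PMF.pure [], fun h => (hz h).elim⟩
  choose κ hκ using this
  obtain ⟨D, hD, hDμ, hDt⟩ := Runs.maximize (x := X.pres) hμ fun z hz => (hκ z hz).1
  have hout : outSet X.n D = (μ.bind κ).map (toSet X.n) := by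
    rw [← hDμ, PMF.map_comp]; rfl
  have hκf : ∀ z ∈ μ.support, (κ z).support.Finite := fun z hz => (hκ z hz).1.finite
  refine ⟨D, hD, ?_, ?_, ?_⟩
  · intro y hy
    refine (hDt y hy).trans ?_
    rw [Polynomial.eval_add, Polynomial.eval_add, hR]
    -- The bound is a polynomial in one variable, so `n` is first raised to the full input size.
    have := greedyTime_mono (n := X.n) (s := X.size) (Nat.le_add_right _ _) (P.eval X.size)
    simp only [Polynomial.eval_ofNat]
    omega
  · intro S hS
    rw [hout, PMF.mem_support_map_iff] at hS
    obtain ⟨l, hl, rfl⟩ := hS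
    rw [PMF.mem_support_bind_iff] at hl
    obtain ⟨z, hz, hl⟩ := hl
    exact (hκ z hz).2.1 _ ((PMF.mem_support_map_iff _ _ _).2 ⟨l, hl, rfl⟩)
  · intro M hM
    obtain rfl := hM.unique hgreat
    rw [expect_eq_mean, hout, mean_map (finite_support_bind hμ.finite hκf),
      mean_bind hμ.finite hκf]
    refine le_trans ?_ (mean_mono hμ.finite fun z hz => (hκ z hz).2.2)
    by_cases hO0 : f O = 0
    · rw [hO0, mul_zero]
      refine (mean_const hμ.finite 0).ge.trans (mean_mono hμ.finite fun z hz => ?_)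
      obtain ⟨u, hu, rfl⟩ := hsupp z hz
      simp only [getD_ofFn]
      exact (h0 ∅).trans (le_multilinear (fun i => mem_Icc_of_mem_polytope hu i) _ hf ∅)
    · rw [if_neg hO0] at hBdef
      rw [hBdef] at hmean
      exact (approx_bound X.n (h0 O)).trans hmean
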